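/- Let $n\ge 1$, let $\mathbb H^n=\mathbb C^n\times\mathbb R$ be the Heisenberg group with product $(z,t)\cdot(w,s)=(z+w,\,t+s+2\operatorname{Im}(z\cdot\overline w))$ and Lebesgue measure, and let $Q=2n+2$. Write $z_i=x_i+\mathrm{i}y_i$, let $X_i=\partial_{x_i}+2y_i\partial_t$, $Y_i=\partial_{y_i}-2x_i\partial_t$ $(1\le i\le n)$, and let $\nabla_{\mathbb H^n}u=\sum_i (X_iu)X_i+(Y_iu)Y_i$ with $|\nabla_{\mathbb H^n}u|^2=\sum_i (X_iu)^2+(Y_iu)^2$, derivatives being understood in the weak sense. Let $\delta_\lambda(z,t)=(\lambda z,\lambda^2t)$ and $|(z,t)|=(|z|^4+t^2)^{1/4}$. For $T>1$ let $\Omega_T=\{x\in\mathbb H^n : 1\le |x|\le T\}$ and let $X_T$ be the space of all real functions $u\in L^2_{\rm loc}(\mathbb H^n\setminus\{0\})$ with weak derivatives $X_iu,Y_iu\in L^2_{\rm loc}(\mathbb H^n\setminus\{0\})$ for all $i$ such that $u\circ\delta_T=T^{-\frac{Q-2}{2}}u$ almost everywhere, with the norm $\|u\|_{X_T}=\big(\int_{\Omega_T}|\nabla_{\mathbb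 H^n}u|^2\big)^{1/2}$. Then there is a constant $C$, depending only on $n$ and in particular independent of $T$, such that for every $T>1$ and every $u\in X_T$ $$\|u\|_{L^{\frac{2Q}{Q-2}}(\Omega_T)}\le C\,(\log T)^{\frac{Q-2}{2Q}}\left(\frac{T^Q}{T^Q-1}\right)^{1/2}\|u\|_{X_T}.$$ -/

import Mathlib

open MeasureTheory
open scoped ContDiff ENNReal

namespace Heisenberg

/-- The Heisenberg group `ℍⁿ = ℂⁿ × ℝ` as a manifold; its `volume` is Lebesgue measure, which is
the Haar measure of the group law `(z, t) (w, s) = (z + w, t + s + 2 Im (z · w̄))`. -/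
abbrev Heis (n : ℕ) : Type := (Fin n → ℂ) × ℝ

/-- The homogeneous dimension `Q = 2n + 2`. -/
def homDim (n : ℕ) : ℕ := 2 * n + 2

/-- The dilations `δ_r (z, t) = (r z, r² t)`. -/
def dilation {n : ℕ} (r : ℝ) (p : Heis n) : Heis n :=
  (fun i => (r : ℂ) * p.1 i, r ^ 2 * p.2)

/-- The homogeneous norm `|(z, t)| = (|z|⁴ + t²)^{1/4}`, where `|z|² = ∑ |zᵢ|²`. -/
noncomputable def homNorm {n : ℕ} (p : Heis n) : ℝ :=
  ((∑ i, ‖p.1 i‖ ^ 2) ^ 2 + p.2 ^ 2) ^ (1 / 4 : ℝ)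

/-- The closed annulus `Ω_T = {1 ≤ |x| ≤ T}`, a fundamental domain (up to null sets) of `δ_T`. -/
def annulus (n : ℕ) (T : ℝ) : Set (Heis n) :=
  {p | 1 ≤ homNorm p ∧ homNorm p ≤ T}

/-- The horizontal left invariant frame: `Sum.inl i` is `X_i = ∂_{x_i} + 2 y_i ∂_t` and
`Sum.inr i` is `Y_i = ∂_{y_i} - 2 x_i ∂_t`, where `z_i = x_i + i y_i`. -/
noncomputable def frame {n : ℕ} : Fin n ⊕ Fin n → Heis n → Heis n
  | Sum.inl i, p => (Pi.single i 1, 2 * (p.1 i).im)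
  | Sum.inr i, p => (Pi.single i Complex.I, -2 * (p.1 i).re)

/-- The derivative of a (differentiable) function along a field of the horizontal frame. -/
noncomputable def frameDeriv {n : ℕ} (j : Fin n ⊕ Fin n) (φ : Heis n → ℝ) (p : Heis n) : ℝ :=
  fderiv ℝ φ p (frame j p)

/-- `f ∈ L²_loc(U)`. -/
def MemL2loc {n : ℕ} (U : Set (Heis n)) (f : Heis n → ℝ) : Prop :=
  ∀ K : Set (Heis n), IsCompact K → K ⊆ U → MemLp f 2 (volume.restrict K)

/-- `g ∈ L²_loc(U)` is the weak derivative of `u` in `U` along the `j`-th field of the frame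
(all these fields are divergence free). -/
def IsWeakFrameDeriv {n : ℕ} (U : Set (Heis n)) (j : Fin n ⊕ Fin n) (u g : Heis n → ℝ) : Prop :=
  MemL2loc U g ∧
    ∀ φ : Heis n → ℝ, ContDiff ℝ ∞ φ → HasCompactSupport φ → tsupport φ ⊆ U →
      ∫ p, u p * frameDeriv j φ p = -∫ p, g p * φ p

/-- `u ∈ S¹_loc(U)`: the function and its weak horizontal derivatives are in `L²_loc(U)`. -/
def MemS1loc {n : ℕ} (U : Set (Heis n)) (u : Heis n → ℝ) : Prop :=
  MemL2loc U u ∧ ∀ j, ∃ g, IsWeakFrameDeriv U j u g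

open Classical in
/-- The components of the weak subriemannian gradient of `u` in `U` with respect to the
orthonormal frame (zero if the weak derivative does not exist). -/
noncomputable def weakGrad {n : ℕ} (U : Set (Heis n)) (u : Heis n → ℝ) (j : Fin n ⊕ Fin n) :
    Heis n → ℝ :=
  if h : ∃ g, IsWeakFrameDeriv U j u g then h.choose else 0

/-- The space `X_T` of the functions in `S¹_loc(ℍⁿ ∖ {0})` with
`u ∘ δ_T = T^{-(Q-2)/2} u` almost everywhere. -/
def XSpace (n : ℕ) (T : ℝ) : Set (Heis n → ℝ) :=
  {u | MemS1loc {0}ᶜ u ∧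
    ∀ᵐ p : Heis n, u (dilation T p) = T ^ (-(((homDim n : ℝ) - 2) / 2)) * u p}

/-- The scalar product `⟨u, v⟩ = ∫_{Ω_T} ∇u · ∇v` of `X_T`. -/
noncomputable def XInner {n : ℕ} (T : ℝ) (u v : Heis n → ℝ) : ℝ :=
  ∫ p in annulus n T, ∑ j, weakGrad {0}ᶜ u j p * weakGrad {0}ᶜ v j p

/-- The norm of `X_T`. -/
noncomputable def XNorm {n : ℕ} (T : ℝ) (u : Heis n → ℝ) : ℝ :=
  √(XInner T u u)

theorem MemL2loc.locallyIntegrableOn {n : ℕ} {U : Set (Heis n)} (hU : IsOpen U)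
    {f : Heis n → ℝ} (hf : MemL2loc U f) : LocallyIntegrableOn f U := by
  rw [locallyIntegrableOn_iff hU.isLocallyClosed]
  intro K hKU hK
  haveI : IsFiniteMeasure ((volume : Measure (Heis n)).restrict K) :=
    ⟨by simpa using hK.measure_lt_top⟩
  exact (hf K hK hKU).integrable (by norm_num)

/-- Weak derivatives are unique up to null sets, so that `weakGrad` and `XNorm` do not depend on
the choice made. -/
theorem IsWeakFrameDeriv.ae_eq {n : ℕ} {U : Set (Heis n)} (hU : IsOpen U) {j : Fin n ⊕ Fin n}
    {u g h : Heis n → ℝ} (hg : IsWeakFrameDeriv U j u g) (hh : IsWeakFrameDeriv U j u h) :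
    ∀ᵐ p, p ∈ U → g p = h p := by
  have hgi := hg.1.locallyIntegrableOn hU
  have hhi := hh.1.locallyIntegrableOn hU
  have key := hU.ae_eq_zero_of_integral_contDiff_smul_eq_zero (hgi.sub hhi) (by
    intro φ hφ hc hs
    have hi : ∀ f : Heis n → ℝ, LocallyIntegrableOn f U → Integrable fun p => f p * φ p := by
      intro f hf
      have h1 : IntegrableOn f (tsupport φ) := hf.integrableOn_compact_subset hs hc
      have h2 : IntegrableOn (fun p => f p * φ p) (tsupport φ) :=
        h1.mul_continuousOn hφ.continuous.continuousOn hc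
      refine (integrableOn_iff_integrable_of_support_subset ?_).1 h2
      intro p hp
      exact subset_tsupport φ (fun h0 => hp (by simp [h0]))
    have e : (fun p => φ p • (g - h) p) = fun p => g p * φ p - h p * φ p := by
      funext p; simp [mul_sub, mul_comm]
    rw [e, integral_sub (hi g hgi) (hi h hhi)]
    have := hg.2 φ hφ hc hs
    have := hh.2 φ hφ hc hs
    linarith)
  filter_upwards [key] with p hp hpU
  exact sub_eq_zero.1 (hp hpU)

end Heisenberg

/-!
On the Heisenberg group, `‖f (· h) - f‖₂ ≤ 3 |h| ‖∇f‖₂`: for horizontal `h` this is the fundamental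
theorem of calculus along a horizontal segment, and any `h` is a horizontal element times a
commutator of two horizontal elements, all of size at most `|h|`. If `f` is supported in a set of
volume small compared with that of the ball of radius `r`, then half of the differences
`f (x h) - f x` with `|h| ≤ r` equal `-f x`; so averaging over `h` bounds the volume of the level
sets of `f`. Applied to dyadic truncations of `f` this gives the Sobolev inequality
`‖f‖_q² ≤ C ‖∇f‖₂²`, `q = 2Q/(Q-2)`, for compactly supported `f`.

For `u` in `X_T` put `R = T ^ k` and multiply `u` by a cutoff in `log |x| / log R` which is `1` on
`R ≤ |x| ≤ R²` and is supported in `1 ≤ |x| ≤ R³`. Both regions are unions of whole periods, so the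
Sobolev inequality compares multiples of the integrals over a single period. As
`∫ |x| ^ (-Q)` over `1 ≤ |x| ≤ R³` is of order `log R`, Hölder's inequality bounds the cutoff error
by `O(1 / log R)` times the left-hand side, and it is absorbed once `k log T ≥ A` for a constant
`A`. Taking `k = ⌈A / log T⌉` costs the factor `k ^ (1/Q)`, which is of order
`max 1 (1 / log T) ^ (1/Q)`.
-/

namespace Heisenberg

open Set Filter Topology

variable {n : ℕ}

/-! ### The group law -/

/-- The symplectic form `Im (a · b̄)` on `ℂⁿ`. -/
def sympl (a b : Fin n → ℂ) : ℝ := (a ⬝ᵥ star b).im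

/-- The product `(z, t) (w, s) = (z + w, t + s + 2 Im (z · w̄))` of the Heisenberg group; its unit
is `0` and the inverse of `p` is `-p`. -/
def hmul (p q : Heis n) : Heis n := (p.1 + q.1, p.2 + q.2 + 2 * sympl p.1 q.1)

theorem sympl_add_left (a b c : Fin n → ℂ) : sympl (a + b) c = sympl a c + sympl b c := by
  simp [sympl, add_dotProduct]

theorem sympl_add_right (a b c : Fin n → ℂ) : sympl a (b + c) = sympl a b + sympl a c := by
  simp [sympl, dotProduct_add]

theorem sympl_smul_left (s : ℝ) (a b : Fin n → ℂ) : sympl (s • a) b = s * sympl a b := by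
  simp [sympl, smul_dotProduct]

theorem sympl_smul_right (s : ℝ) (a b : Fin n → ℂ) : sympl a (s • b) = s * sympl a b := by
  simp [sympl, star_smul, dotProduct_smul]

theorem sympl_neg_left (a b : Fin n → ℂ) : sympl (-a) b = -sympl a b := by
  simp [sympl]

theorem sympl_neg_right (a b : Fin n → ℂ) : sympl a (-b) = -sympl a b := by
  simp [sympl]

theorem sympl_swap (a b : Fin n → ℂ) : sympl b a = -sympl a b := by
  simp only [sympl, dotProduct, Complex.im_sum, Pi.star_apply, ← Finset.sum_neg_distrib]
  exact Finset.sum_congr rfl fun i _ => by simp; ring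

@[simp] theorem sympl_self (a : Fin n → ℂ) : sympl a a = 0 :=
  self_eq_neg.1 (sympl_swap a a)

@[simp] theorem sympl_zero_left (a : Fin n → ℂ) : sympl 0 a = 0 := by simp [sympl]

@[simp] theorem sympl_zero_right (a : Fin n → ℂ) : sympl a 0 = 0 := by simp [sympl]

theorem hmul_assoc (p q r : Heis n) : hmul (hmul p q) r = hmul p (hmul q r) := by
  refine Prod.ext (add_assoc _ _ _) ?_
  simp only [hmul, sympl_add_left, sympl_add_right]
  ring

@[simp] theorem hmul_zero (p : Heis n) : hmul p 0 = p := by simp [hmul]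

@[simp] theorem zero_hmul (p : Heis n) : hmul 0 p = p := by simp [hmul]

@[simp] theorem neg_hmul_self (p : Heis n) : hmul (-p) p = 0 := by simp [hmul, sympl_neg_left]

@[simp] theorem hmul_neg_self (p : Heis n) : hmul p (-p) = 0 := by simp [hmul, sympl_neg_right]

theorem neg_hmul (p q : Heis n) : -hmul p q = hmul (-q) (-p) := by
  refine Prod.ext (neg_add_rev _ _) ?_
  simp only [hmul, Prod.snd_neg, Prod.fst_neg, sympl_neg_left, sympl_neg_right, neg_neg]
  rw [sympl_swap p.1 q.1]
  ring

@[fun_prop]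
theorem contDiff_sympl {E : Type*} [NormedAddCommGroup E] [NormedSpace ℝ E] {k : WithTop ℕ∞}
    {f g : E → Fin n → ℂ} (hf : ContDiff ℝ k f) (hg : ContDiff ℝ k g) :
    ContDiff ℝ k fun x => sympl (f x) (g x) := by
  have hfi : ∀ i, ContDiff ℝ k fun x => f x i := contDiff_pi.1 hf
  have hgi : ∀ i, ContDiff ℝ k fun x => g x i := contDiff_pi.1 hg
  exact Complex.imCLM.contDiff.comp
    (ContDiff.sum fun i _ => (hfi i).mul (Complex.conjCLE.contDiff.comp (hgi i)))

@[fun_prop]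
theorem contDiff_hmul {E : Type*} [NormedAddCommGroup E] [NormedSpace ℝ E] {k : WithTop ℕ∞}
    {f g : E → Heis n} (hf : ContDiff ℝ k f) (hg : ContDiff ℝ k g) :
    ContDiff ℝ k fun x => hmul (f x) (g x) := by
  unfold hmul
  fun_prop

@[fun_prop]
theorem continuous_hmul {α : Type*} [TopologicalSpace α] {f g : α → Heis n} (hf : Continuous f)
    (hg : Continuous g) : Continuous fun x => hmul (f x) (g x) :=
  (contDiff_hmul (k := 0) contDiff_fst contDiff_snd).continuous.comp (hf.prodMk hg)

@[fun_prop]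
theorem measurable_hmul {α : Type*} [MeasurableSpace α] {f g : α → Heis n} (hf : Measurable f)
    (hg : Measurable g) : Measurable fun x => hmul (f x) (g x) :=
  (continuous_hmul continuous_fst continuous_snd).measurable.comp (hf.prodMk hg)

/-- Left translation as a homeomorphism. -/
def hmulLeft (p : Heis n) : Heis n ≃ₜ Heis n where
  toFun x := hmul p x
  invFun x := hmul (-p) x
  left_inv x := by simp [← hmul_assoc]
  right_inv x := by simp [← hmul_assoc]

/-- Right translation as a homeomorphism. -/
def hmulRight (p : Heis n) : Heis n ≃ₜ Heis n where
  toFun x := hmul x p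
  invFun x := hmul x (-p)
  left_inv x := by simp [hmul_assoc]
  right_inv x := by simp [hmul_assoc]

theorem measurePreserving_hmul_left (p : Heis n) :
    MeasurePreserving fun x : Heis n => hmul p x := by
  refine MeasurePreserving.skew_product (measurePreserving_add_left volume p.1)
    (g := fun z t => p.2 + t + 2 * sympl p.1 z)
    (measurable_snd.comp (measurable_hmul measurable_const measurable_id))
    (Eventually.of_forall fun z => ?_)
  simpa only [add_right_comm _ _ (2 * sympl p.1 z)] using
    (measurePreserving_add_left volume (p.2 + 2 * sympl p.1 z)).map_eq

theorem measurePreserving_hmul_right (p : Heis n) :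
    MeasurePreserving fun x : Heis n => hmul x p := by
  refine MeasurePreserving.skew_product (measurePreserving_add_right volume p.1)
    (g := fun z t => t + p.2 + 2 * sympl z p.1)
    (measurable_snd.comp (measurable_hmul measurable_id measurable_const))
    (Eventually.of_forall fun z => ?_)
  simpa only [add_assoc] using
    (measurePreserving_add_right volume (p.2 + 2 * sympl z p.1)).map_eq

theorem lintegral_hmul_left (F : Heis n → ℝ≥0∞) (p : Heis n) :
    ∫⁻ x, F (hmul p x) = ∫⁻ x, F x :=
  (measurePreserving_hmul_left p).lintegral_comp_emb (hmulLeft p).measurableEmbedding F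

theorem lintegral_hmul_right (F : Heis n → ℝ≥0∞) (p : Heis n) :
    ∫⁻ x, F (hmul x p) = ∫⁻ x, F x :=
  (measurePreserving_hmul_right p).lintegral_comp_emb (hmulRight p).measurableEmbedding F

/-! ### Dilations and the homogeneous norm -/

theorem dilation_eq_smul (r : ℝ) (p : Heis n) : dilation r p = (r • p.1, r ^ 2 • p.2) :=
  Prod.ext (funext fun i => by simp [dilation]) (by simp [dilation])

theorem contDiff_dilation (r : ℝ) {k : WithTop ℕ∞} :
    ContDiff ℝ k (dilation r : Heis n → Heis n) := by
  rw [funext (dilation_eq_smul r)]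
  fun_prop

theorem dilation_dilation (r s : ℝ) (p : Heis n) :
    dilation r (dilation s p) = dilation (r * s) p := by
  simp only [dilation_eq_smul, smul_smul, mul_pow]

@[simp] theorem dilation_one (p : Heis n) : dilation 1 p = p := by simp [dilation_eq_smul]

/-- The dilation by `r ≠ 0` as a homeomorphism. -/
noncomputable def dilationHomeomorph (r : ℝ) (hr : r ≠ 0) : Heis n ≃ₜ Heis n where
  toFun := dilation r
  invFun := dilation r⁻¹
  left_inv x := by simp [dilation_dilation, hr]
  right_inv x := by simp [dilation_dilation, hr]
  continuous_toFun := (contDiff_dilation (k := 0) r).continuous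
  continuous_invFun := (contDiff_dilation (k := 0) r⁻¹).continuous

theorem map_dilation {r : ℝ} (hr : 0 < r) :
    Measure.map (dilation r) (volume : Measure (Heis n)) =
      ENNReal.ofReal (r ^ homDim n)⁻¹ • volume := by
  have hprod : (dilation r : Heis n → Heis n) = Prod.map (r • ·) (r ^ 2 • ·) :=
    funext (dilation_eq_smul r)
  rw [hprod, Measure.volume_eq_prod,
    ← Measure.map_prod_map _ _ (measurable_const_smul r) (measurable_const_smul (r ^ 2)),
    Measure.map_addHaar_smul _ hr.ne', Measure.map_addHaar_smul _ (pow_pos hr 2).ne',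
    Measure.prod_smul_left, Measure.prod_smul_right, smul_smul,
    ← ENNReal.ofReal_mul (abs_nonneg _), abs_of_pos (by positivity), abs_of_pos (by positivity),
    ← mul_inv]
  simp [homDim, Module.finrank_pi_fintype, pow_add, mul_comm]

theorem lintegral_dilation {r : ℝ} (hr : 0 < r) (F : Heis n → ℝ≥0∞) :
    ∫⁻ x, F (dilation r x) = ENNReal.ofReal (r ^ homDim n)⁻¹ * ∫⁻ x, F x := by
  have hemb := (dilationHomeomorph (n := n) r hr.ne').measurableEmbedding
  rw [← show ∫⁻ x, F x ∂Measure.map (dilation r) volume = ∫⁻ x, F (dilation r x) from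
    hemb.lintegral_map F, map_dilation hr, lintegral_smul_measure, smul_eq_mul]

theorem integral_dilation {r : ℝ} (hr : 0 < r) (F : Heis n → ℝ) :
    ∫ x, F (dilation r x) = (r ^ homDim n)⁻¹ * ∫ x, F x := by
  have hemb := (dilationHomeomorph (n := n) r hr.ne').measurableEmbedding
  rw [← show ∫ x, F x ∂Measure.map (dilation r) volume = ∫ x, F (dilation r x) from
    hemb.integral_map F, map_dilation hr, integral_smul_measure, smul_eq_mul,
    ENNReal.toReal_ofReal (by positivity)]

/-- The polynomial `|z|⁴ + t²`, the fourth power of `homNorm`; unlike `homNorm` it is smooth at the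
origin. -/
noncomputable def koranyiPoly (p : Heis n) : ℝ := (∑ i, ‖p.1 i‖ ^ 2) ^ 2 + p.2 ^ 2

theorem koranyiPoly_nonneg (p : Heis n) : 0 ≤ koranyiPoly p := by
  unfold koranyiPoly
  positivity

theorem contDiff_koranyiPoly {k : WithTop ℕ∞} : ContDiff ℝ k (koranyiPoly : Heis n → ℝ) := by
  have hcoord : ∀ i, ContDiff ℝ k fun p : Heis n => ‖p.1 i‖ ^ 2 := fun i =>
    ((contDiff_apply ℝ ℂ i).comp contDiff_fst).norm_sq ℝ
  exact ((ContDiff.sum fun i _ => hcoord i).pow 2).add (contDiff_snd.pow 2)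

theorem homNorm_nonneg (p : Heis n) : 0 ≤ homNorm p :=
  Real.rpow_nonneg (koranyiPoly_nonneg p) _

theorem homNorm_pow_four (p : Heis n) : homNorm p ^ 4 = koranyiPoly p := by
  change (koranyiPoly p ^ (1 / 4 : ℝ)) ^ 4 = _
  rw [← Real.rpow_mul_natCast (koranyiPoly_nonneg p)]
  norm_num

theorem sum_norm_sq_le_homNorm_sq (p : Heis n) : ∑ i, ‖p.1 i‖ ^ 2 ≤ homNorm p ^ 2 := by
  refine le_of_sq_le_sq ?_ (sq_nonneg _)
  rw [← pow_mul, homNorm_pow_four, koranyiPoly]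
  linarith [sq_nonneg p.2]

theorem abs_snd_le_homNorm_sq (p : Heis n) : |p.2| ≤ homNorm p ^ 2 := by
  refine abs_le_of_sq_le_sq ?_ (sq_nonneg _)
  rw [← pow_mul, homNorm_pow_four, koranyiPoly]
  linarith [sq_nonneg (∑ i, ‖p.1 i‖ ^ 2)]

theorem norm_fst_apply_le_homNorm (p : Heis n) (i : Fin n) : ‖p.1 i‖ ≤ homNorm p :=
  le_of_sq_le_sq ((Finset.single_le_sum (f := fun i => ‖p.1 i‖ ^ 2) (fun _ _ => by positivity)
    (Finset.mem_univ i)).trans (sum_norm_sq_le_homNorm_sq p)) (homNorm_nonneg p)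

@[simp] theorem homNorm_eq_zero_iff {p : Heis n} : homNorm p = 0 ↔ p = 0 := by
  refine ⟨fun h => Prod.ext (funext fun i => ?_) ?_, fun h => by simp [h, homNorm]⟩
  · exact norm_le_zero_iff.1 (h ▸ norm_fst_apply_le_homNorm p i)
  · have := abs_snd_le_homNorm_sq p
    rw [h] at this
    exact abs_nonpos_iff.1 (by simpa using this)

theorem homNorm_pos {p : Heis n} (hp : p ≠ 0) : 0 < homNorm p :=
  (homNorm_nonneg p).lt_of_ne' (mt homNorm_eq_zero_iff.1 hp)

theorem koranyiPoly_pos {p : Heis n} (hp : p ≠ 0) : 0 < koranyiPoly p :=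
  homNorm_pow_four p ▸ pow_pos (homNorm_pos hp) 4

theorem continuous_homNorm : Continuous (homNorm : Heis n → ℝ) :=
  (contDiff_koranyiPoly (k := 0)).continuous.rpow_const fun _ => Or.inr (by norm_num)

theorem homNorm_dilation {r : ℝ} (hr : 0 < r) (p : Heis n) :
    homNorm (dilation r p) = r * homNorm p := by
  refine (pow_left_inj₀ (homNorm_nonneg _) (by positivity [homNorm_nonneg p]) four_ne_zero).1 ?_
  simp only [mul_pow, homNorm_pow_four, koranyiPoly, dilation, norm_mul, ← Finset.mul_sum,
    Complex.norm_real, Real.norm_eq_abs, sq_abs]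
  ring

/-- The closed ball of radius `r` about the origin for the homogeneous norm. -/
def homBall (n : ℕ) (r : ℝ) : Set (Heis n) := {p | homNorm p ≤ r}

theorem isCompact_homBall (r : ℝ) : IsCompact (homBall n r) := by
  refine (isCompact_closedBall (0 : Heis n) (max r (r ^ 2))).of_isClosed_subset
    (isClosed_le continuous_homNorm continuous_const) fun p (hp : homNorm p ≤ r) => ?_
  have hr : 0 ≤ r := (homNorm_nonneg p).trans hp
  rw [mem_closedBall_zero_iff, Prod.norm_def]
  refine max_le_max ((pi_norm_le_iff_of_nonneg hr).2 fun i => ?_) ?_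
  · exact (norm_fst_apply_le_homNorm p i).trans hp
  · exact (abs_snd_le_homNorm_sq p).trans (pow_le_pow_left₀ (homNorm_nonneg p) hp 2)

theorem measurableSet_homBall (r : ℝ) : MeasurableSet (homBall n r) :=
  (isCompact_homBall r).measurableSet

theorem volume_homBall_eq_ofReal_mul {r : ℝ} (hr : 0 < r) :
    volume (homBall n r) = ENNReal.ofReal (r ^ homDim n) * volume (homBall n 1) := by
  have hpre : homBall n r = dilation r⁻¹ ⁻¹' homBall n 1 := by
    ext p
    simp [homBall, homNorm_dilation (inv_pos.2 hr), inv_mul_le_iff₀ hr]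
  rw [hpre, ← Measure.map_apply (contDiff_dilation (k := 0) _).continuous.measurable
    (measurableSet_homBall 1), map_dilation (inv_pos.2 hr)]
  simp

theorem volume_homBall_one_pos (n : ℕ) : 0 < volume (homBall n 1) := by
  have hopen : IsOpen {p : Heis n | homNorm p < 1} := isOpen_lt continuous_homNorm continuous_const
  have hzero : homNorm (0 : Heis n) < 1 := (homNorm_eq_zero_iff.2 rfl).trans_lt one_pos
  exact (hopen.measure_pos volume ⟨0, hzero⟩).trans_le
    (measure_mono fun _ (hp : homNorm _ < 1) => hp.le)

/-! ### Differences along the group -/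

/-- The direction in `ℂⁿ` of a field of the horizontal frame. -/
noncomputable def frameDir : Fin n ⊕ Fin n → Fin n → ℂ :=
  Sum.elim (fun i => Pi.single i 1) (fun i => Pi.single i Complex.I)

theorem frame_eq (j : Fin n ⊕ Fin n) (p : Heis n) :
    frame j p = (frameDir j, 2 * sympl p.1 (frameDir j)) := by
  cases j <;> simp [frame, frameDir, sympl]

theorem contDiff_frame {k : WithTop ℕ∞} (j : Fin n ⊕ Fin n) :
    ContDiff ℝ k (frame j : Heis n → Heis n) := by
  rw [funext (frame_eq j)]
  fun_prop

theorem horizontal_eq_sum_smul_frame (w : Fin n → ℂ) (x : Heis n) :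
    ((w, 2 * sympl x.1 w) : Heis n) =
      ∑ j, Sum.elim (fun i => (w i).re) (fun i => (w i).im) j • frame j x := by
  have hw : w = ∑ j, Sum.elim (fun i => (w i).re) (fun i => (w i).im) j • frameDir j := by
    funext k
    simp [frameDir, Finset.sum_apply, Pi.single_apply]
  refine Prod.ext ?_ ?_
  · simpa [Prod.fst_sum, frame_eq] using hw
  · have hlin : ∀ c : Fin n ⊕ Fin n → ℝ,
        sympl x.1 (∑ j, c j • frameDir j) = ∑ j, c j * sympl x.1 (frameDir j) := fun c => by
      simp [sympl, dotProduct_sum, star_sum, star_smul, dotProduct_smul]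
    simp only [Prod.snd_sum, frame_eq, Prod.smul_snd, smul_eq_mul]
    rw [congrArg (sympl x.1) hw, hlin, Finset.mul_sum]
    exact Finset.sum_congr rfl fun j _ => by ring

/-- The squared length `∑ j, (X_j f)²` of the horizontal gradient of a differentiable function. -/
noncomputable def horizontalGradSq (f : Heis n → ℝ) (x : Heis n) : ℝ≥0∞ :=
  ∑ j, ‖frameDeriv j f x‖ₑ ^ 2

theorem continuous_frameDeriv {f : Heis n → ℝ} (hf : ContDiff ℝ 1 f) (j : Fin n ⊕ Fin n) :
    Continuous (frameDeriv j f) :=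
  (hf.continuous_fderiv one_ne_zero).clm_apply (contDiff_frame (k := 0) j).continuous

theorem continuous_horizontalGradSq {f : Heis n → ℝ} (hf : ContDiff ℝ 1 f) :
    Continuous (horizontalGradSq f) :=
  continuous_finsetSum _ fun j _ =>
    (ENNReal.continuous_pow 2).comp (continuous_frameDeriv hf j).enorm

theorem enorm_sq_fderiv_horizontal_le (f : Heis n → ℝ) (w : Fin n → ℂ) (x : Heis n) :
    ‖fderiv ℝ f x (w, 2 * sympl x.1 w)‖ₑ ^ 2 ≤
      ENNReal.ofReal (∑ i, ‖w i‖ ^ 2) * horizontalGradSq f x := by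
  set c : Fin n ⊕ Fin n → ℝ := Sum.elim (fun i => (w i).re) (fun i => (w i).im)
  have hc : ∑ j, c j ^ 2 = ∑ i, ‖w i‖ ^ 2 := by
    simp only [c, Fintype.sum_sum_type, Sum.elim_inl, Sum.elim_inr, ← Finset.sum_add_distrib,
      Complex.sq_norm, Complex.normSq_apply, ← sq]
  have hsq : ∀ a : ℝ, ‖a‖ₑ ^ 2 = ENNReal.ofReal (a ^ 2) := fun a => by
    rw [← ofReal_norm, ← ENNReal.ofReal_pow (norm_nonneg a), Real.norm_eq_abs, sq_abs]
  rw [horizontal_eq_sum_smul_frame, map_sum]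
  simp only [horizontalGradSq, hsq, map_smul, smul_eq_mul]
  rw [← ENNReal.ofReal_sum_of_nonneg fun _ _ => sq_nonneg _,
    ← ENNReal.ofReal_mul (by positivity), ← hc]
  exact ENNReal.ofReal_le_ofReal (Finset.sum_mul_sq_le_sq_mul_sq _ _ _)

theorem hasDerivAt_hmul_line {f : Heis n → ℝ} (hf : Differentiable ℝ f) (x : Heis n)
    (w : Fin n → ℂ) (s : ℝ) :
    HasDerivAt (fun s : ℝ => f (hmul x (s • w, 0)))
      (fderiv ℝ f (hmul x (s • w, 0)) (w, 2 * sympl (hmul x (s • w, 0)).1 w)) s := by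
  have hfst : HasDerivAt (fun s : ℝ => x.1 + s • w) w s := by
    simpa using ((hasDerivAt_id s).smul_const w).const_add x.1
  have hsnd : HasDerivAt (fun s : ℝ => x.2 + 0 + 2 * (s * sympl x.1 w)) (2 * sympl x.1 w) s := by
    simpa using (((hasDerivAt_id s).mul_const (sympl x.1 w)).const_mul 2).const_add (x.2 + 0)
  have hline : HasDerivAt (fun s : ℝ => hmul x (s • w, 0))
      (w, 2 * sympl (hmul x (s • w, 0)).1 w) s := by
    simpa [hmul, sympl_smul_right, sympl_add_left, sympl_smul_left] using hfst.prodMk hsnd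
  exact (hf _).hasFDerivAt.comp_hasDerivAt s hline

theorem sq_lintegral_le_lintegral_sq {α : Type*} [MeasurableSpace α] (μ : Measure α)
    [IsProbabilityMeasure μ] {g : α → ℝ≥0∞} (hg : AEMeasurable g μ) :
    (∫⁻ a, g a ∂μ) ^ 2 ≤ ∫⁻ a, g a ^ 2 ∂μ := by
  have h := ENNReal.lintegral_mul_le_Lp_mul_Lq μ Real.HolderConjugate.two_two hg
    (aemeasurable_const (b := (1 : ℝ≥0∞)))
  simp only [Pi.mul_apply, mul_one, ENNReal.one_rpow, lintegral_const, measure_univ] at h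
  calc (∫⁻ a, g a ∂μ) ^ 2 ≤ ((∫⁻ a, g a ^ (2 : ℝ) ∂μ) ^ (1 / 2 : ℝ)) ^ 2 := by gcongr
    _ = ∫⁻ a, g a ^ 2 ∂μ := by
      rw [← ENNReal.rpow_natCast, ← ENNReal.rpow_mul]
      norm_num

theorem enorm_sq_horizontal_difference_le {f : Heis n → ℝ} (hf : ContDiff ℝ 1 f)
    (w : Fin n → ℂ) (x : Heis n) :
    ‖f (hmul x (w, 0)) - f x‖ₑ ^ 2 ≤ ∫⁻ s in Ioc (0 : ℝ) 1,
      ENNReal.ofReal (∑ i, ‖w i‖ ^ 2) * horizontalGradSq f (hmul x (s • w, 0)) := by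
  set f' : ℝ → ℝ := fun s =>
    fderiv ℝ f (hmul x (s • w, 0)) (w, 2 * sympl (hmul x (s • w, 0)).1 w)
  have hline : ContDiff ℝ 0 fun s : ℝ => hmul x ((s • w, 0) : Heis n) := by fun_prop
  have hcont : Continuous f' :=
    ((hf.continuous_fderiv one_ne_zero).comp hline.continuous).clm_apply
      (contDiff_const.prodMk (contDiff_const.mul
        (contDiff_sympl (contDiff_fst.comp hline) contDiff_const))).continuous
  have hprob : IsProbabilityMeasure (volume.restrict (Ioc (0 : ℝ) 1)) := ⟨by simp⟩
  have hFTC : f (hmul x (w, 0)) - f x = ∫ s in Ioc (0 : ℝ) 1, f' s := by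
    have h := intervalIntegral.integral_eq_sub_of_hasDerivAt (a := 0) (b := 1)
      (fun s _ => hasDerivAt_hmul_line (hf.differentiable one_ne_zero) x w s)
      (hcont.intervalIntegrable 0 1)
    rw [intervalIntegral.integral_of_le zero_le_one] at h
    simpa [← Prod.zero_eq_mk] using h.symm
  rw [hFTC]
  calc ‖∫ s in Ioc (0 : ℝ) 1, f' s‖ₑ ^ 2 ≤ (∫⁻ s in Ioc (0 : ℝ) 1, ‖f' s‖ₑ) ^ 2 := by
        gcongr
        exact enorm_integral_le_lintegral_enorm _
    _ ≤ ∫⁻ s in Ioc (0 : ℝ) 1, ‖f' s‖ₑ ^ 2 :=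
        sq_lintegral_le_lintegral_sq _ hcont.enorm.measurable.aemeasurable
    _ ≤ _ := lintegral_mono fun s => enorm_sq_fderiv_horizontal_le f w _

theorem lintegral_sq_horizontal_difference_le {f : Heis n → ℝ} (hf : ContDiff ℝ 1 f)
    (w : Fin n → ℂ) :
    ∫⁻ x, ‖f (hmul x (w, 0)) - f x‖ₑ ^ 2 ≤
      ENNReal.ofReal (∑ i, ‖w i‖ ^ 2) * ∫⁻ x, horizontalGradSq f x := by
  set c := ENNReal.ofReal (∑ i, ‖w i‖ ^ 2)
  have hmeas : Measurable fun a : Heis n × ℝ =>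
      c * horizontalGradSq f (hmul a.1 (a.2 • w, 0)) :=
    ((continuous_horizontalGradSq hf).comp (by fun_prop)).measurable.const_mul c
  calc ∫⁻ x, ‖f (hmul x (w, 0)) - f x‖ₑ ^ 2
      ≤ ∫⁻ x, ∫⁻ s in Ioc (0 : ℝ) 1, c * horizontalGradSq f (hmul x (s • w, 0)) :=
        lintegral_mono (enorm_sq_horizontal_difference_le hf w)
    _ = ∫⁻ s in Ioc (0 : ℝ) 1, ∫⁻ x, c * horizontalGradSq f (hmul x (s • w, 0)) :=
        lintegral_lintegral_swap hmeas.aemeasurable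
    _ = ∫⁻ _ in Ioc (0 : ℝ) 1, c * ∫⁻ x, horizontalGradSq f x := by
        refine lintegral_congr fun s => ?_
        rw [lintegral_const_mul' _ _ ENNReal.ofReal_ne_top, lintegral_hmul_right]
    _ = c * ∫⁻ x, horizontalGradSq f x := by simp

theorem eLpNorm_two_sq {α : Type*} [MeasurableSpace α] (μ : Measure α) (g : α → ℝ) :
    eLpNorm g 2 μ ^ 2 = ∫⁻ a, ‖g a‖ₑ ^ 2 ∂μ := by
  simpa using eLpNorm_nnreal_pow_eq_lintegral (f := g) (μ := μ) (p := 2) two_ne_zero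

/-- The `L²` norm of the right difference `x ↦ f (x p) - f x`. -/
noncomputable def diffNorm (f : Heis n → ℝ) (p : Heis n) : ℝ≥0∞ :=
  eLpNorm (fun x => f (hmul x p) - f x) 2 volume

theorem diffNorm_hmul_le {f : Heis n → ℝ} (hf : Continuous f) (p q : Heis n) :
    diffNorm f (hmul p q) ≤ diffNorm f p + diffNorm f q := by
  have hsm : ∀ r, AEStronglyMeasurable (fun x => f (hmul x r) - f x) := fun r =>
    ((hf.comp (continuous_hmul continuous_id continuous_const)).sub hf).aestronglyMeasurable
  have hp := measurePreserving_hmul_right p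
  have hsplit : (fun x => f (hmul x (hmul p q)) - f x) =
      (fun x => f (hmul x p) - f x) + (fun x => f (hmul x q) - f x) ∘ fun x => hmul x p := by
    funext x
    simp [hmul_assoc]
  calc diffNorm f (hmul p q)
      ≤ diffNorm f p + eLpNorm ((fun x => f (hmul x q) - f x) ∘ fun x => hmul x p) 2 volume := by
        rw [diffNorm, hsplit]
        exact eLpNorm_add_le (hsm p) ((hsm q).comp_measurePreserving hp) one_le_two
    _ = diffNorm f p + diffNorm f q := by
        rw [eLpNorm_comp_measurePreserving (hsm q) hp, diffNorm, diffNorm]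

theorem diffNorm_horizontal_le {f : Heis n → ℝ} (hf : ContDiff ℝ 1 f) {w : Fin n → ℂ} {r : ℝ}
    (hr : 0 ≤ r) (hw : ∑ i, ‖w i‖ ^ 2 ≤ r ^ 2) :
    diffNorm f (w, 0) ≤ ENNReal.ofReal r * (∫⁻ x, horizontalGradSq f x) ^ (1 / 2 : ℝ) := by
  refine (ENNReal.pow_le_pow_left_iff two_ne_zero).1 ?_
  rw [diffNorm, eLpNorm_two_sq, mul_pow, ← ENNReal.rpow_mul_natCast, ← ENNReal.ofReal_pow hr]
  refine (lintegral_sq_horizontal_difference_le hf w).trans ?_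
  norm_num
  gcongr

theorem hmul_commutator (a b : Fin n → ℂ) :
    hmul (hmul (a, 0) (b, 0)) (hmul (-a, 0) (-b, 0)) = (0, 4 * sympl a b) := by
  refine Prod.ext (by simp [hmul, ← neg_add_rev, add_comm]) ?_
  simp only [hmul, sympl_add_left, sympl_add_right, sympl_neg_left, sympl_neg_right, sympl_self]
  linear_combination -2 * sympl_swap a b

theorem sum_norm_sq_single (i : Fin n) (c : ℂ) :
    ∑ k, ‖(Pi.single i c : Fin n → ℂ) k‖ ^ 2 = ‖c‖ ^ 2 := by
  rw [Finset.sum_eq_single i (fun k _ hk => by simp [Pi.single_eq_of_ne hk]) (by simp),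
    Pi.single_eq_same]

/-- Any vertical element is a commutator of horizontal ones, whose size is the square root of its
height. -/
theorem exists_horizontal_factorization (hn : 1 ≤ n) (p : Heis n) :
    ∃ a b : Fin n → ℂ, ∑ i, ‖a i‖ ^ 2 ≤ (homNorm p / 2) ^ 2 ∧ ∑ i, ‖b i‖ ^ 2 ≤ (homNorm p / 2) ^ 2 ∧
      p = hmul (p.1, 0) (hmul (hmul (a, 0) (b, 0)) (hmul (-a, 0) (-b, 0))) := by
  let i : Fin n := ⟨0, hn⟩
  let σ : ℝ := SignType.sign p.2
  set s : ℝ := √|p.2| / 2 with hs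
  have hs0 : 0 ≤ s := by positivity
  have hsN : s ≤ homNorm p / 2 := by
    rw [hs]
    gcongr
    exact Real.sqrt_le_iff.2 ⟨homNorm_nonneg p, abs_snd_le_homNorm_sq p⟩
  have hσ : |σ| ≤ 1 := by
    rcases lt_trichotomy p.2 0 with h | h | h <;> simp [σ, h]
  have hab : 4 * sympl (Pi.single i (s * Complex.I)) (Pi.single i ((σ * s : ℝ) : ℂ)) = p.2 := by
    have hform : sympl (Pi.single i (s * Complex.I)) (Pi.single i ((σ * s : ℝ) : ℂ)) =
        s * (σ * s) := by
      simp [sympl]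
    linear_combination 4 * hform + σ * Real.mul_self_sqrt (abs_nonneg p.2) + sign_mul_abs p.2
  refine ⟨Pi.single i (s * Complex.I), Pi.single i ((σ * s : ℝ) : ℂ), ?_, ?_, ?_⟩
  · rw [sum_norm_sq_single]
    gcongr
    simpa [abs_of_nonneg hs0] using hsN
  · rw [sum_norm_sq_single, Complex.norm_real, Real.norm_eq_abs, abs_mul, abs_of_nonneg hs0]
    gcongr
    exact (mul_le_of_le_one_left hs0 hσ).trans hsN
  · rw [hmul_commutator, hab]
    simp [hmul]

theorem diffNorm_le (hn : 1 ≤ n) {f : Heis n → ℝ} (hf : ContDiff ℝ 1 f) (p : Heis n) :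
    diffNorm f p ≤
      ENNReal.ofReal (3 * homNorm p) * (∫⁻ x, horizontalGradSq f x) ^ (1 / 2 : ℝ) := by
  obtain ⟨a, b, ha, hb, hfac⟩ := exists_horizontal_factorization hn p
  set N := homNorm p
  set G := (∫⁻ x, horizontalGradSq f x) ^ (1 / 2 : ℝ)
  have hN : 0 ≤ N := homNorm_nonneg p
  have hhalf : ∀ w : Fin n → ℂ, ∑ i, ‖w i‖ ^ 2 ≤ (N / 2) ^ 2 →
      diffNorm f (w, 0) ≤ ENNReal.ofReal (N / 2) * G :=
    fun w hw => diffNorm_horizontal_le hf (by positivity) hw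
  have htri := diffNorm_hmul_le hf.continuous
  calc diffNorm f p ≤ diffNorm f (p.1, 0) + ((diffNorm f (a, 0) + diffNorm f (b, 0)) +
        (diffNorm f (-a, 0) + diffNorm f (-b, 0))) := by
        nth_rewrite 1 [hfac]
        exact (htri _ _).trans (add_le_add_right ((htri _ _).trans
          (add_le_add (htri _ _) (htri _ _))) _)
    _ ≤ ENNReal.ofReal N * G + ((ENNReal.ofReal (N / 2) * G + ENNReal.ofReal (N / 2) * G) +
        (ENNReal.ofReal (N / 2) * G + ENNReal.ofReal (N / 2) * G)) := by
        gcongr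
        · exact diffNorm_horizontal_le hf hN (sum_norm_sq_le_homNorm_sq p)
        · exact hhalf a ha
        · exact hhalf b hb
        · exact hhalf (-a) (by simpa using ha)
        · exact hhalf (-b) (by simpa using hb)
    _ = ENNReal.ofReal (3 * N) * G := by
        rw [← add_mul, ← add_mul, ← add_mul]
        repeat rw [← ENNReal.ofReal_add (by positivity) (by positivity)]
        congr 2
        ring

/-! ### The Folland–Stein inequality for functions of class `C¹` -/

/-- At least half of any ball large compared with the support of `h` is a set where `h` vanishes. -/
theorem sq_mul_volume_homBall_le {h : Heis n → ℝ} (hh : Continuous h) {r l : ℝ}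
    (hr : 2 * volume {x | h x ≠ 0} ≤ volume (homBall n r)) {x : Heis n} (hl : 0 ≤ l)
    (hx : l ≤ |h x|) :
    ENNReal.ofReal (l ^ 2) * volume (homBall n r) ≤
      2 * ∫⁻ p in homBall n r, ‖h (hmul x p) - h x‖ₑ ^ 2 := by
  set B := homBall n r
  set Z : Set (Heis n) := {p | h (hmul x p) ≠ 0} with hZ
  have hZm : MeasurableSet Z :=
    (isOpen_ne_fun (hh.comp (continuous_hmul continuous_const continuous_id))
      continuous_const).measurableSet
  have hZvol : volume Z = volume {x | h x ≠ 0} :=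
    (measurePreserving_hmul_left x).measure_preimage_emb (hmulLeft x).measurableEmbedding
      {x | h x ≠ 0}
  have hB : volume B ≠ ⊤ := (isCompact_homBall r).measure_lt_top.ne
  have hhalf : volume B ≤ 2 * volume (B \ Z) := by
    have hZ2 : 2 * volume Z ≤ volume B := hZvol ▸ hr
    have hcover : volume B ≤ volume (B \ Z) + volume Z := by
      rw [← measure_sdiff_add_inter B hZm]
      exact add_le_add_right (measure_mono inter_subset_right) _
    refine (ENNReal.add_le_add_iff_right hB).1 ?_
    calc volume B + volume B ≤ 2 * volume (B \ Z) + 2 * volume Z := by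
          rw [← two_mul, ← mul_add]
          gcongr
      _ ≤ 2 * volume (B \ Z) + volume B := by gcongr
  calc ENNReal.ofReal (l ^ 2) * volume B
      ≤ ENNReal.ofReal (l ^ 2) * (2 * volume (B \ Z)) := by gcongr
    _ = 2 * ∫⁻ _ in B \ Z, ENNReal.ofReal (l ^ 2) := by
        rw [setLIntegral_const]
        ring
    _ ≤ 2 * ∫⁻ p in B \ Z, ‖h (hmul x p) - h x‖ₑ ^ 2 := by
        gcongr 2 * ?_
        refine setLIntegral_mono' ((measurableSet_homBall r).diff hZm) fun p hp => ?_
        have hp0 : h (hmul x p) = 0 := by simpa [hZ] using hp.2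
        rw [hp0, zero_sub, enorm_neg, ENNReal.ofReal_pow hl, ← ofReal_norm]
        gcongr
        exact hx
    _ ≤ 2 * ∫⁻ p in B, ‖h (hmul x p) - h x‖ₑ ^ 2 := by
        gcongr
        exact sdiff_subset

theorem lintegral_homBall_lintegral_sq_difference_le (hn : 1 ≤ n) {h : Heis n → ℝ}
    (hh : ContDiff ℝ 1 h) {r : ℝ} (hr : 0 ≤ r) :
    ∫⁻ p in homBall n r, ∫⁻ x, ‖h (hmul x p) - h x‖ₑ ^ 2 ≤
      volume (homBall n r) * (ENNReal.ofReal (9 * r ^ 2) * ∫⁻ x, horizontalGradSq h x) := by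
  rw [mul_comm, ← setLIntegral_const]
  refine setLIntegral_mono' (measurableSet_homBall r) fun p hp => ?_
  rw [← eLpNorm_two_sq]
  calc diffNorm h p ^ 2
      ≤ (ENNReal.ofReal (3 * r) * (∫⁻ x, horizontalGradSq h x) ^ (1 / 2 : ℝ)) ^ 2 := by
        refine pow_le_pow_left' ((diffNorm_le hn hh p).trans ?_) 2
        gcongr
        exact hp
    _ = ENNReal.ofReal (9 * r ^ 2) * ∫⁻ x, horizontalGradSq h x := by
        rw [mul_pow, ← ENNReal.rpow_mul_natCast, ← ENNReal.ofReal_pow (by positivity)]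
        norm_num [mul_pow]

theorem sq_mul_volume_level_le (hn : 1 ≤ n) {h : Heis n → ℝ} (hh : ContDiff ℝ 1 h) {r l : ℝ}
    (hr0 : 0 < r) (hr : 2 * volume {x | h x ≠ 0} ≤ volume (homBall n r)) (hl : 0 ≤ l) :
    ENNReal.ofReal (l ^ 2) * volume {x | l ≤ |h x|} ≤
      ENNReal.ofReal (18 * r ^ 2) * ∫⁻ x, horizontalGradSq h x := by
  set B := homBall n r
  set A := {x | l ≤ |h x|}
  have hA : MeasurableSet A := (isClosed_le continuous_const hh.continuous.abs).measurableSet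
  have hpair : Measurable fun a : Heis n × Heis n => ‖h (hmul a.1 a.2) - h a.1‖ₑ ^ 2 :=
    ((hh.continuous.comp (continuous_hmul continuous_fst continuous_snd)).sub
      (hh.continuous.comp continuous_fst)).enorm.measurable.pow_const 2
  have hB0 : volume B ≠ 0 := by
    rw [volume_homBall_eq_ofReal_mul hr0]
    exact (ENNReal.mul_pos (by simpa using by positivity) (volume_homBall_one_pos n).ne').ne'
  have hBtop : volume B ≠ ⊤ := (isCompact_homBall r).measure_lt_top.ne
  refine (ENNReal.mul_le_mul_iff_right hB0 hBtop).1 ?_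
  calc volume B * (ENNReal.ofReal (l ^ 2) * volume A)
      = ∫⁻ _ in A, ENNReal.ofReal (l ^ 2) * volume B := by
        rw [setLIntegral_const]
        ring
    _ ≤ ∫⁻ x in A, 2 * ∫⁻ p in B, ‖h (hmul x p) - h x‖ₑ ^ 2 :=
        setLIntegral_mono' hA fun x hx => sq_mul_volume_homBall_le hh.continuous hr hl hx
    _ ≤ 2 * ∫⁻ x, ∫⁻ p in B, ‖h (hmul x p) - h x‖ₑ ^ 2 := by
        rw [← lintegral_const_mul' _ _ (by simp)]
        exact setLIntegral_le_lintegral _ _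
    _ = 2 * ∫⁻ p in B, ∫⁻ x, ‖h (hmul x p) - h x‖ₑ ^ 2 := by
        rw [lintegral_lintegral_swap hpair.aemeasurable]
    _ ≤ 2 * (volume B * (ENNReal.ofReal (9 * r ^ 2) * ∫⁻ x, horizontalGradSq h x)) := by
        gcongr
        exact lintegral_homBall_lintegral_sq_difference_le hn hh hr0.le
    _ = volume B * (ENNReal.ofReal (18 * r ^ 2) * ∫⁻ x, horizontalGradSq h x) := by
        rw [show 18 * r ^ 2 = 2 * (9 * r ^ 2) by ring, ENNReal.ofReal_mul zero_le_two,
          ENNReal.ofReal_ofNat]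
        ring

/-- The critical Sobolev exponent `2Q/(Q-2)`. -/
noncomputable def sobExp (n : ℕ) : ℝ := 2 * (homDim n : ℝ) / ((homDim n : ℝ) - 2)

theorem four_le_homDim (hn : 1 ≤ n) : (4 : ℝ) ≤ homDim n := by
  have : (1 : ℝ) ≤ n := by exact_mod_cast hn
  simp only [homDim]
  push_cast
  linarith

theorem sobExp_pos (hn : 1 ≤ n) : 0 < sobExp n := by
  have := four_le_homDim hn
  exact div_pos (by linarith) (by linarith)

theorem two_div_sobExp (hn : 1 ≤ n) : 2 / sobExp n = 1 - 2 / (homDim n : ℝ) := by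
  have hQ := four_le_homDim hn
  have hQ0 : (homDim n : ℝ) ≠ 0 := by linarith
  have hQ2 : (homDim n : ℝ) - 2 ≠ 0 := by linarith
  rw [sobExp]
  field_simp

theorem sobExp_sub_two (hn : 1 ≤ n) : sobExp n - 2 = sobExp n * (2 / (homDim n : ℝ)) := by
  have h := two_div_sobExp hn
  have hq := (sobExp_pos hn).ne'
  field_simp at h ⊢
  linear_combination -h

/-- A smooth bump on the line, equal to `1` on `[-1/2, 1/2]` and supported in `[-1, 1]`. -/
noncomputable def levelBump : ContDiffBump (0 : ℝ) := ⟨1 / 2, 1, by norm_num, by norm_num⟩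

/-- A smooth truncation of `s` at the level `l`: it is `0` for `|s| ≤ l / 2` and `l` for
`l ≤ |s|`. -/
noncomputable def trunc (l s : ℝ) : ℝ := l * (1 - levelBump (l⁻¹ * s))

theorem contDiff_trunc (l : ℝ) {k : ℕ∞} : ContDiff ℝ k (trunc l) :=
  contDiff_const.mul (contDiff_const.sub
    ((levelBump.contDiff (n := k)).comp (contDiff_const.mul contDiff_id)))

theorem trunc_eq_zero {l s : ℝ} (hl : 0 < l) (hs : |s| ≤ l / 2) : trunc l s = 0 := by
  have hball : l⁻¹ * s ∈ Metric.closedBall (0 : ℝ) levelBump.rIn := by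
    rw [mem_closedBall_zero_iff, Real.norm_eq_abs, abs_mul, abs_of_pos (inv_pos.2 hl),
      inv_mul_le_iff₀ hl]
    exact hs.trans_eq (div_eq_mul_one_div l 2)
  simp [trunc, levelBump.one_of_mem_closedBall hball]

theorem trunc_eq_level {l s : ℝ} (hl : 0 < l) (hs : l ≤ |s|) : trunc l s = l := by
  have hdist : levelBump.rOut ≤ dist (l⁻¹ * s) 0 := by
    rw [dist_zero_right, Real.norm_eq_abs, abs_mul, abs_of_pos (inv_pos.2 hl),
      le_inv_mul_iff₀ hl]
    exact (mul_one l).trans_le hs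
  simp [trunc, levelBump.zero_of_le_dist hdist]

theorem deriv_trunc_eq_zero {l s : ℝ} (hl : 0 < l) (hs : |s| ∉ Ioc (l / 2) l) :
    deriv (trunc l) s = 0 := by
  rw [mem_Ioc, not_and_or, not_lt, not_le] at hs
  rcases hs with hs | hs
  · refine IsLocalMin.deriv_eq_zero (Eventually.of_forall fun t => ?_)
    rw [trunc_eq_zero hl hs]
    exact mul_nonneg hl.le (sub_nonneg.2 levelBump.le_one)
  · refine IsLocalMax.deriv_eq_zero (Eventually.of_forall fun t => ?_)
    rw [trunc_eq_level hl hs.le]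
    exact mul_le_of_le_one_right hl.le (sub_le_self _ levelBump.nonneg)

theorem deriv_trunc {l : ℝ} (hl : l ≠ 0) (s : ℝ) :
    deriv (trunc l) s = -deriv levelBump (l⁻¹ * s) := by
  have hd : Differentiable ℝ levelBump := (levelBump.contDiff (n := 1)).differentiable one_ne_zero
  have h : HasDerivAt (trunc l) (l * (0 - deriv levelBump (l⁻¹ * s) * (l⁻¹ * 1))) s :=
    ((hasDerivAt_const _ _).sub
      ((hd _).hasDerivAt.comp s ((hasDerivAt_id s).const_mul l⁻¹))).const_mul l
  rw [h.deriv]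
  field_simp
  ring

theorem exists_abs_deriv_trunc_le :
    ∃ B : ℝ, 0 < B ∧ ∀ l : ℝ, 0 < l → ∀ s, |deriv (trunc l) s| ≤ B := by
  obtain ⟨B, hB⟩ := levelBump.hasCompactSupport.deriv.exists_bound_of_continuous
    ((levelBump.contDiff (n := 1)).continuous_deriv le_rfl)
  refine ⟨max B 1, by positivity, fun l hl s => ?_⟩
  rw [deriv_trunc hl.ne', abs_neg]
  exact (hB _).trans (le_max_left _ _)

theorem frameDeriv_comp {g : ℝ → ℝ} {f : Heis n → ℝ} {x : Heis n} {g' : ℝ}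
    (hg : HasDerivAt g g' (f x)) (hf : DifferentiableAt ℝ f x) (j : Fin n ⊕ Fin n) :
    frameDeriv j (fun y => g (f y)) x = g' * frameDeriv j f x := by
  have h : HasFDerivAt (fun y => g (f y)) (g' • fderiv ℝ f x) x :=
    HasDerivAt.comp_hasFDerivAt (h₂ := g) x hg hf.hasFDerivAt
  rw [frameDeriv, h.fderiv, frameDeriv, smul_apply, smul_eq_mul]

theorem horizontalGradSq_comp {g : ℝ → ℝ} (hg : Differentiable ℝ g) {f : Heis n → ℝ}
    (hf : Differentiable ℝ f) (x : Heis n) :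
    horizontalGradSq (fun y => g (f y)) x = ‖deriv g (f x)‖ₑ ^ 2 * horizontalGradSq f x := by
  simp only [horizontalGradSq, frameDeriv_comp (hg _).hasDerivAt (hf x), enorm_mul, mul_pow,
    Finset.mul_sum]

theorem lintegral_horizontalGradSq_trunc_le {B : ℝ} (hB : 0 < B)
    (hbound : ∀ l : ℝ, 0 < l → ∀ s, |deriv (trunc l) s| ≤ B) {f : Heis n → ℝ}
    (hf : ContDiff ℝ 1 f) {l : ℝ} (hl : 0 < l) :
    ∫⁻ x, horizontalGradSq (fun y => trunc l (f y)) x ≤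
      ENNReal.ofReal (B ^ 2) * ∫⁻ x in {x | |f x| ∈ Ioc (l / 2) l}, horizontalGradSq f x := by
  have hband : MeasurableSet {x | |f x| ∈ Ioc (l / 2) l} :=
    hf.continuous.abs.measurable measurableSet_Ioc
  rw [← lintegral_const_mul' _ _ ENNReal.ofReal_ne_top, ← lintegral_indicator hband]
  refine lintegral_mono fun x => ?_
  dsimp only
  rw [horizontalGradSq_comp ((contDiff_trunc l (k := 1)).differentiable one_ne_zero)
    (hf.differentiable one_ne_zero)]
  by_cases hx : |f x| ∈ Ioc (l / 2) l
  · rw [indicator_of_mem (by exact hx), ENNReal.ofReal_pow hB.le, ← ofReal_norm]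
    gcongr
    exact hbound l hl _
  · rw [indicator_of_notMem (by exact hx), deriv_trunc_eq_zero hl hx]
    simp

theorem exists_sq_eq_and_ofReal_le_volume_homBall (n : ℕ) :
    ∃ K : ℝ, 0 < K ∧ ∀ V : ℝ, 0 < V → ∃ r : ℝ, 0 < r ∧ r ^ 2 = K * V ^ (2 / (homDim n : ℝ)) ∧
      ENNReal.ofReal V ≤ volume (homBall n r) := by
  have hball : volume (homBall n 1) ≠ ⊤ := (isCompact_homBall 1).measure_lt_top.ne
  set c := (volume (homBall n 1)).toReal
  have hc : 0 < c := ENNReal.toReal_pos (volume_homBall_one_pos n).ne' hball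
  have hQ : (homDim n : ℝ) ≠ 0 := Nat.cast_ne_zero.2 (Nat.succ_ne_zero _)
  refine ⟨c⁻¹ ^ (2 / (homDim n : ℝ)), by positivity, fun V hV => ?_⟩
  refine ⟨(c⁻¹ * V) ^ (1 / (homDim n : ℝ)), by positivity, ?_, ?_⟩
  · rw [← Real.rpow_mul_natCast (by positivity), ← Real.mul_rpow (by positivity) hV.le]
    congr 1
    push_cast
    ring
  · rw [volume_homBall_eq_ofReal_mul (by positivity), ← Real.rpow_mul_natCast (by positivity),
      one_div_mul_cancel hQ, Real.rpow_one, ← ENNReal.ofReal_toReal hball,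
      ← ENNReal.ofReal_mul (by positivity)]
    exact ENNReal.ofReal_le_ofReal (by field_simp; rfl)

theorem volume_trunc_ne_zero_le {f : Heis n → ℝ} (hf : Continuous f) {q m l : ℝ} (hq : 0 ≤ q)
    (hl : 0 < l) (hm : ∫⁻ x, ‖f x‖ₑ ^ q ≤ ENNReal.ofReal m) :
    volume {x | trunc l (f x) ≠ 0} ≤ ENNReal.ofReal ((l / 2) ^ (-q) * m) := by
  have hpos : 0 < (l / 2) ^ q := by positivity
  have hsub : {x | trunc l (f x) ≠ 0} ⊆ {x | ENNReal.ofReal ((l / 2) ^ q) ≤ ‖f x‖ₑ ^ q} := by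
    intro x hx
    have hlx : l / 2 ≤ ‖f x‖ := by
      by_contra! hlt
      exact hx (trunc_eq_zero hl hlt.le)
    change ENNReal.ofReal ((l / 2) ^ q) ≤ ‖f x‖ₑ ^ q
    rw [← ofReal_norm, ENNReal.ofReal_rpow_of_nonneg (norm_nonneg _) hq]
    gcongr
  refine (ENNReal.mul_le_mul_iff_right (by simpa using hpos) ENNReal.ofReal_ne_top).1 ?_
  calc ENNReal.ofReal ((l / 2) ^ q) * volume {x | trunc l (f x) ≠ 0}
      ≤ ENNReal.ofReal ((l / 2) ^ q) * volume {x | ENNReal.ofReal ((l / 2) ^ q) ≤ ‖f x‖ₑ ^ q} := by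
        gcongr
    _ ≤ ∫⁻ x, ‖f x‖ₑ ^ q := mul_meas_ge_le_lintegral (hf.enorm.measurable.pow_const q) _
    _ ≤ ENNReal.ofReal m := hm
    _ = ENNReal.ofReal ((l / 2) ^ q) * ENNReal.ofReal ((l / 2) ^ (-q) * m) := by
        rw [← ENNReal.ofReal_mul hpos.le, Real.rpow_neg (by positivity),
          mul_inv_cancel_left₀ hpos.ne']

theorem exists_rpow_mul_volume_level_le (hn : 1 ≤ n) :
    ∃ C : ℝ, 0 < C ∧ ∀ f : Heis n → ℝ, ContDiff ℝ 1 f → ∀ m : ℝ, 0 < m →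
      ∫⁻ x, ‖f x‖ₑ ^ sobExp n ≤ ENNReal.ofReal m → ∀ l : ℝ, 0 < l →
      ENNReal.ofReal (l ^ sobExp n) * volume {x | l ≤ |f x|} ≤
        ENNReal.ofReal (C * m ^ (2 / (homDim n : ℝ))) *
          ∫⁻ x in {x | |f x| ∈ Ioc (l / 2) l}, horizontalGradSq f x := by
  obtain ⟨K, hK, hradius⟩ := exists_sq_eq_and_ofReal_le_volume_homBall n
  obtain ⟨B, hB, hbound⟩ := exists_abs_deriv_trunc_le
  have hq := sobExp_pos hn
  have hsub := sobExp_sub_two hn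
  set q := sobExp n
  set θ : ℝ := 2 / (homDim n : ℝ)
  refine ⟨18 * (K * 2 ^ θ * 2 ^ (q - 2)) * B ^ 2, by positivity, fun f hf m hm hfm l hl => ?_⟩
  obtain ⟨r, hr, hrsq, hrvol⟩ := hradius (2 * ((l / 2) ^ (-q) * m)) (by positivity)
  have hsmall : 2 * volume {x | trunc l (f x) ≠ 0} ≤ volume (homBall n r) := by
    refine le_trans ?_ hrvol
    rw [ENNReal.ofReal_mul zero_le_two, ENNReal.ofReal_ofNat]
    gcongr
    exact volume_trunc_ne_zero_le hf.continuous hq.le hl hfm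
  have hlevel : {x | l ≤ |f x|} ⊆ {x | l ≤ |trunc l (f x)|} := fun x hx => by
    rw [mem_ofPred_eq, trunc_eq_level hl hx, abs_of_pos hl]
  have hrsq' : l ^ (q - 2) * r ^ 2 = K * 2 ^ θ * 2 ^ (q - 2) * m ^ θ := by
    have hscale : l ^ (q - 2) * (l / 2) ^ (-q * θ) = 2 ^ (q - 2) := by
      rw [neg_mul, ← hsub, Real.rpow_neg (by positivity), Real.div_rpow hl.le zero_le_two]
      field_simp
    rw [hrsq, Real.mul_rpow zero_le_two (by positivity), Real.mul_rpow (by positivity) hm.le,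
      ← Real.rpow_mul (by positivity), ← hscale]
    ring
  set G := ∫⁻ x in {x | |f x| ∈ Ioc (l / 2) l}, horizontalGradSq f x
  calc ENNReal.ofReal (l ^ q) * volume {x | l ≤ |f x|}
      = ENNReal.ofReal (l ^ (q - 2)) * (ENNReal.ofReal (l ^ 2) * volume {x | l ≤ |f x|}) := by
        rw [← mul_assoc, ← ENNReal.ofReal_mul (by positivity), ← Real.rpow_natCast l 2,
          ← Real.rpow_add hl]
        norm_num
    _ ≤ ENNReal.ofReal (l ^ (q - 2)) *
        (ENNReal.ofReal (18 * r ^ 2) * (ENNReal.ofReal (B ^ 2) * G)) := by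
        gcongr ENNReal.ofReal (l ^ (q - 2)) * ?_
        refine (mul_le_mul_right (measure_mono hlevel) _).trans ((sq_mul_volume_level_le hn
          ((contDiff_trunc l (k := 1)).comp hf) hr hsmall hl.le).trans ?_)
        gcongr
        exact lintegral_horizontalGradSq_trunc_le hB hbound hf hl
    _ = ENNReal.ofReal (18 * (K * 2 ^ θ * 2 ^ (q - 2)) * B ^ 2 * m ^ θ) * G := by
        rw [← mul_assoc, ← mul_assoc, ← ENNReal.ofReal_mul (by positivity),
          ← ENNReal.ofReal_mul (by positivity)]
        congr 2
        linear_combination 18 * B ^ 2 * hrsq'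

theorem lintegral_rpow_le_tsum_zpow {α : Type*} [MeasurableSpace α] (μ : Measure α) {f : α → ℝ}
    (hf : Measurable f) {q : ℝ} (hq : 0 < q) :
    ∫⁻ x, ‖f x‖ₑ ^ q ∂μ ≤ ENNReal.ofReal (2 ^ q) *
      ∑' k : ℤ, ENNReal.ofReal (((2 : ℝ) ^ k) ^ q) * μ {x | (2 : ℝ) ^ k ≤ |f x|} := by
  have hlevel : ∀ k : ℤ, MeasurableSet {x | (2 : ℝ) ^ k ≤ |f x|} := fun k =>
    measurableSet_le measurable_const hf.abs
  have hterm : ∀ k : ℤ, ENNReal.ofReal (((2 : ℝ) ^ k) ^ q) * μ {x | (2 : ℝ) ^ k ≤ |f x|} =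
      ∫⁻ x, {x | (2 : ℝ) ^ k ≤ |f x|}.indicator
        (fun _ => ENNReal.ofReal (((2 : ℝ) ^ k) ^ q)) x ∂μ := fun k => by
    rw [lintegral_indicator_const (hlevel k)]
  simp_rw [hterm]
  rw [← lintegral_tsum fun k => (measurable_const.indicator (hlevel k)).aemeasurable,
    ← lintegral_const_mul' _ _ ENNReal.ofReal_ne_top]
  refine lintegral_mono fun x => ?_
  dsimp only
  rcases eq_or_ne (f x) 0 with hx | hx
  · simp [hx, hq]
  · obtain ⟨k, hk, hk'⟩ := exists_mem_Ico_zpow (abs_pos.2 hx) (one_lt_two (α := ℝ))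
    refine le_trans ?_ (mul_le_mul_right (ENNReal.le_tsum k) _)
    rw [indicator_of_mem (by exact hk), ← ofReal_norm, ← ENNReal.ofReal_mul (by positivity),
      ← Real.mul_rpow zero_le_two (by positivity), ← zpow_one_add₀ two_ne_zero, add_comm,
      ENNReal.ofReal_rpow_of_nonneg (norm_nonneg _) hq.le]
    gcongr
    exact hk'.le

theorem tsum_setLIntegral_dyadic_le {α : Type*} [MeasurableSpace α] (μ : Measure α) {f : α → ℝ}
    (hf : Measurable f) (G : α → ℝ≥0∞) :
    ∑' k : ℤ, ∫⁻ x in {x | |f x| ∈ Ioc ((2 : ℝ) ^ k / 2) (2 ^ k)}, G x ∂μ ≤ ∫⁻ x, G x ∂μ := by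
  have hmono : Monotone fun k : ℤ => (2 : ℝ) ^ k := zpow_right_mono₀ one_le_two
  have hdisj : Pairwise (Function.onFun Disjoint
      fun k : ℤ => {x | |f x| ∈ Ioc ((2 : ℝ) ^ k / 2) (2 ^ k)}) := fun i j hij => by
    have h := hmono.pairwise_disjoint_on_Ioc_pred hij
    simp only [Function.onFun, Order.pred_eq_sub_one, zpow_sub_one₀ (two_ne_zero (α := ℝ)),
      ← div_eq_mul_inv] at h
    exact h.preimage fun x => |f x|
  have hmeas : ∀ k : ℤ, MeasurableSet {x | |f x| ∈ Ioc ((2 : ℝ) ^ k / 2) (2 ^ k)} :=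
    fun k => hf.abs measurableSet_Ioc
  rw [← lintegral_iUnion hmeas hdisj]
  exact setLIntegral_le_lintegral _ _

theorem lintegral_enorm_rpow_lt_top_of_hasCompactSupport {f : Heis n → ℝ} (hf : Continuous f)
    (hfc : HasCompactSupport f) {q : ℝ} (hq : 0 < q) : ∫⁻ x, ‖f x‖ₑ ^ q < ⊤ := by
  have hmem : MemLp f (ENNReal.ofReal q) volume := hf.memLp_of_hasCompactSupport hfc
  simpa [hq.le] using
    lintegral_rpow_enorm_lt_top_of_eLpNorm_lt_top (by simpa using hq) ENNReal.ofReal_ne_top hmem.2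

/-- The level estimates carry the factor `‖f‖_q ^ (2q/Q)`; summed over dyadic levels it is absorbed
in the left-hand side. -/
theorem sobolev_contDiff (hn : 1 ≤ n) :
    ∃ C : ℝ, 0 < C ∧ ∀ f : Heis n → ℝ, ContDiff ℝ 1 f → HasCompactSupport f →
      (∫⁻ x, ‖f x‖ₑ ^ sobExp n) ^ (2 / sobExp n) ≤
        ENNReal.ofReal C * ∫⁻ x, horizontalGradSq f x := by
  obtain ⟨C, hC, hlevel⟩ := exists_rpow_mul_volume_level_le hn
  have hq := sobExp_pos hn
  have hdiv := two_div_sobExp hn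
  set q := sobExp n
  set θ : ℝ := 2 / (homDim n : ℝ)
  refine ⟨2 ^ q * C, by positivity, fun f hf hfc => ?_⟩
  set M := ∫⁻ x, ‖f x‖ₑ ^ q
  set G := ∫⁻ x, horizontalGradSq f x
  have hMtop : M ≠ ⊤ := (lintegral_enorm_rpow_lt_top_of_hasCompactSupport hf.continuous hfc hq).ne
  rcases eq_or_ne M 0 with hM0 | hM0
  · rw [hM0, ENNReal.zero_rpow_of_pos (by positivity)]
    exact zero_le
  set m := M.toReal
  have hm : 0 < m := ENNReal.toReal_pos hM0 hMtop
  have hMm : M = ENNReal.ofReal m := (ENNReal.ofReal_toReal hMtop).symm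
  have hsum : M ≤ ENNReal.ofReal (2 ^ q) * (ENNReal.ofReal (C * m ^ θ) * G) := by
    refine (lintegral_rpow_le_tsum_zpow volume hf.continuous.measurable hq).trans ?_
    gcongr
    refine (ENNReal.tsum_le_tsum fun k => hlevel f hf m hm hMm.le _ (by positivity)).trans ?_
    rw [ENNReal.tsum_mul_left]
    gcongr
    exact tsum_setLIntegral_dyadic_le volume hf.continuous.measurable _
  refine (ENNReal.mul_le_mul_iff_right (a := ENNReal.ofReal (m ^ θ)) (by simpa using by positivity)
    ENNReal.ofReal_ne_top).1 ?_
  calc ENNReal.ofReal (m ^ θ) * M ^ (2 / q) = M := by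
        rw [hMm, ENNReal.ofReal_rpow_of_pos hm, ← ENNReal.ofReal_mul (by positivity),
          ← Real.rpow_add hm, hdiv]
        simp
    _ ≤ ENNReal.ofReal (2 ^ q) * (ENNReal.ofReal (C * m ^ θ) * G) := hsum
    _ = ENNReal.ofReal (m ^ θ) * (ENNReal.ofReal (2 ^ q * C) * G) := by
        rw [← mul_assoc, ← mul_assoc, ← ENNReal.ofReal_mul (by positivity),
          ← ENNReal.ofReal_mul (by positivity)]
        congr 2
        ring

/-! ### Group convolution -/

instance : (volume : Measure (Heis n)).IsAddHaarMeasure :=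
  Measure.prod.instIsAddHaarMeasure volume volume

instance : (volume : Measure (Heis n)).IsNegInvariant :=
  Measure.IsAddHaarMeasure.isNegInvariant_of_regular volume

/-- The group convolution `∫ k (x y⁻¹) v (y) dy`. It commutes with the left invariant fields in its
second argument. -/
noncomputable def hconv (k v : Heis n → ℝ) (x : Heis n) : ℝ := ∫ y, k (hmul x (-y)) * v y

theorem measurePreserving_neg_hmul (x : Heis n) :
    MeasurePreserving fun p : Heis n => hmul (-p) x :=
  (measurePreserving_hmul_right x).comp (Measure.measurePreserving_neg volume)

theorem measurableEmbedding_neg_hmul (x : Heis n) :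
    MeasurableEmbedding fun p : Heis n => hmul (-p) x :=
  (hmulRight x).measurableEmbedding.comp (Homeomorph.neg (Heis n)).measurableEmbedding

theorem hconv_eq_integral_translate (k v : Heis n → ℝ) (x : Heis n) :
    hconv k v x = ∫ p, k p * v (hmul (-p) x) := by
  rw [hconv, ← (measurePreserving_neg_hmul x).integral_comp (measurableEmbedding_neg_hmul x)]
  simp [neg_hmul, ← hmul_assoc]

theorem hconv_congr_ae {k v w : Heis n → ℝ} (h : v =ᵐ[volume] w) : hconv k v = hconv k w := by
  funext x
  exact integral_congr_ae (h.mono fun y hy => by simp only [hy])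

theorem contDiff_hconv {k v : Heis n → ℝ} (hk : ContDiff ℝ ∞ k) (hkc : HasCompactSupport k)
    (hv : LocallyIntegrable v) : ContDiff ℝ ∞ (hconv k v) := by
  have hball : ∀ R : ℝ, ContDiffOn ℝ ∞ (hconv k v) (Metric.ball 0 R) := by
    intro R
    have hK : IsCompact ((fun a : Heis n × Heis n => hmul (-a.1) a.2) ''
        (Metric.closedBall 0 R ×ˢ tsupport k)) :=
      ((isCompact_closedBall 0 R).prod hkc).image (by fun_prop)
    have h := contDiffOn_convolution_right_with_param_comp (μ := volume) (n := ⊤)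
      (ContinuousLinearMap.mul ℝ ℝ) (s := Metric.ball (0 : Heis n) R) (v := fun _ => (0 : Heis n))
      contDiffOn_const (f := v) (g := fun x s => k (hmul x s)) Metric.isOpen_ball hK ?_ hv ?_
    · refine h.congr fun x _ => ?_
      simp only [convolution, hconv, ContinuousLinearMap.mul_apply', zero_sub, mul_comm]
    · intro x s hx hs
      by_contra hne
      exact hs ⟨(x, hmul x s), ⟨Metric.ball_subset_closedBall hx, subset_tsupport _ hne⟩,
        by simp [← hmul_assoc]⟩
    · exact (hk.comp (contDiff_hmul contDiff_fst contDiff_snd)).contDiffOn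
  refine contDiff_iff_contDiffAt.2 fun x => ?_
  exact (hball (‖x‖ + 1)).contDiffAt (Metric.isOpen_ball.mem_nhds (by simp))

theorem hasCompactSupport_hconv {k v : Heis n → ℝ} (hkc : HasCompactSupport k)
    (hvc : HasCompactSupport v) : HasCompactSupport (hconv k v) := by
  refine HasCompactSupport.intro (IsCompact.image (hkc.prod hvc)
    (continuous_hmul continuous_fst continuous_snd)) fun x hx => ?_
  refine integral_eq_zero_of_ae (Eventually.of_forall fun y => ?_)
  by_contra hne
  obtain ⟨hk, hv⟩ := mul_ne_zero_iff.1 hne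
  exact hx ⟨(hmul x (-y), y), ⟨subset_tsupport _ hk, subset_tsupport _ hv⟩, by simp [hmul_assoc]⟩

theorem hasDerivAt_frame_line {f : Heis n → ℝ} (hf : Differentiable ℝ f) (j : Fin n ⊕ Fin n)
    (x : Heis n) :
    HasDerivAt (fun s : ℝ => f (hmul x (s • frameDir j, 0))) (frameDeriv j f x) 0 := by
  simpa [frameDeriv, frame_eq, ← Prod.zero_eq_mk] using hasDerivAt_hmul_line hf x (frameDir j) 0

theorem hasDerivAt_fst_slice {E : Type*} [NormedAddCommGroup E] [NormedSpace ℝ E]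
    {Φ : ℝ × E → ℝ} (hΦ : Differentiable ℝ Φ) (s : ℝ) (y : E) :
    HasDerivAt (fun s => Φ (s, y)) (fderiv ℝ Φ (s, y) (1, 0)) s :=
  (hΦ (s, y)).hasFDerivAt.comp_hasDerivAt s ((hasDerivAt_id s).prodMk (hasDerivAt_const s y))

theorem hasDerivAt_integral_mul_of_contDiff {E : Type*} [NormedAddCommGroup E] [NormedSpace ℝ E]
    [MeasurableSpace E] [BorelSpace E] {μ : Measure E} {Φ : ℝ × E → ℝ} (hΦ : ContDiff ℝ 1 Φ)
    {v : E → ℝ} (hv : Integrable v μ) (hvc : HasCompactSupport v) (s₀ : ℝ) :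
    HasDerivAt (fun s => ∫ y, Φ (s, y) * v y ∂μ) (∫ y, fderiv ℝ Φ (s₀, y) (1, 0) * v y ∂μ) s₀ := by
  have hD : Continuous fun a => fderiv ℝ Φ a (1, 0) :=
    (hΦ.continuous_fderiv one_ne_zero).clm_apply continuous_const
  have hdiff := hΦ.differentiable one_ne_zero
  have hmeas : ∀ {F : ℝ × E → ℝ}, Continuous F → ∀ s,
      AEStronglyMeasurable (fun y => F (s, y) * v y) μ := fun hF s =>
    (hF.comp (by fun_prop : Continuous fun y => (s, y))).aestronglyMeasurable.mul hv.1
  have hbound : ∀ {F : ℝ × E → ℝ}, Continuous F →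
      ∃ B, ∀ y, ∀ s ∈ Metric.ball s₀ 1, ‖F (s, y) * v y‖ ≤ B * ‖v y‖ := fun {F} hF => by
    obtain ⟨B, hB⟩ := ((isCompact_closedBall s₀ 1).prod hvc.isCompact).exists_bound_of_continuousOn
      hF.continuousOn
    refine ⟨B, fun y s hs => ?_⟩
    rcases eq_or_ne (v y) 0 with hy | hy
    · simp [hy]
    · rw [norm_mul]
      gcongr
      exact hB _ ⟨Metric.ball_subset_closedBall hs, subset_tsupport _ hy⟩
  obtain ⟨B, hB⟩ := hbound hΦ.continuous
  obtain ⟨B', hB'⟩ := hbound hD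
  exact (hasDerivAt_integral_of_dominated_loc_of_deriv_le (Metric.ball_mem_nhds s₀ one_pos)
    (Eventually.of_forall (hmeas hΦ.continuous))
    ((hv.norm.const_mul B).mono' (hmeas hΦ.continuous s₀)
      (Eventually.of_forall fun y => hB y s₀ (Metric.mem_ball_self one_pos)))
    (hmeas hD s₀) (Eventually.of_forall hB') (hv.norm.const_mul B')
    (Eventually.of_forall fun y s _ => (hasDerivAt_fst_slice hdiff s y).mul_const (v y))).2

theorem frameDeriv_comp_hmul_neg {k : Heis n → ℝ} (hk : Differentiable ℝ k) (j : Fin n ⊕ Fin n)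
    (x y : Heis n) {d : ℝ}
    (hd : HasDerivAt (fun s : ℝ => k (hmul (hmul x (s • frameDir j, 0)) (-y))) d 0) :
    frameDeriv j (fun y => k (hmul x (-y))) y = -d := by
  have hsmooth : Differentiable ℝ fun y : Heis n => hmul x (-y) :=
    (contDiff_hmul contDiff_const contDiff_neg).differentiable one_ne_zero
  have hline : HasDerivAt (fun s : ℝ => k (hmul x (-hmul y (s • frameDir j, 0)))) _ 0 :=
    hasDerivAt_frame_line (hk.comp hsmooth) j y
  have hswap : (fun s : ℝ => k (hmul x (-hmul y (s • frameDir j, 0)))) =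
      fun s => k (hmul (hmul x ((-s) • frameDir j, 0)) (-y)) := by
    funext s
    simp [neg_hmul, hmul_assoc]
  have hneg :
      HasDerivAt (fun s : ℝ => k (hmul (hmul x ((-s) • frameDir j, 0)) (-y))) (d * -1) 0 :=
    HasDerivAt.comp (h₂ := fun s : ℝ => k (hmul (hmul x (s • frameDir j, 0)) (-y))) 0
      (by simpa using hd) (hasDerivAt_neg (0 : ℝ))
  rw [hswap] at hline
  exact (hline.unique hneg).trans (by ring)

theorem frameDeriv_hconv {k v g : Heis n → ℝ} (hk : ContDiff ℝ ∞ k) (hkc : HasCompactSupport k)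
    (hv : Integrable v) (hvc : HasCompactSupport v) {j : Fin n ⊕ Fin n}
    (hg : IsWeakFrameDeriv univ j v g) : frameDeriv j (hconv k v) = hconv k g := by
  funext x
  set Φ : ℝ × Heis n → ℝ := fun a => k (hmul (hmul x (a.1 • frameDir j, 0)) (-a.2))
  have hΦ : ContDiff ℝ 1 Φ := (hk.of_le (by simp)).comp (by fun_prop)
  have hkernel : ∀ y, frameDeriv j (fun y => k (hmul x (-y))) y = -fderiv ℝ Φ (0, y) (1, 0) :=
    fun y => frameDeriv_comp_hmul_neg (hk.differentiable (by simp)) j x y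
      (hasDerivAt_fst_slice (hΦ.differentiable one_ne_zero) 0 y)
  have hparts := hg.2 (fun y => k (hmul x (-y)))
    (hk.comp (contDiff_hmul contDiff_const contDiff_neg))
    (hkc.comp_homeomorph ((Homeomorph.neg (Heis n)).trans (hmulLeft x))) (subset_univ _)
  have hconv_line := hasDerivAt_frame_line
    ((contDiff_hconv hk hkc hv.locallyIntegrable).differentiable (by simp)) j x
  rw [hconv_line.unique (hasDerivAt_integral_mul_of_contDiff hΦ hv hvc 0), hconv]
  simpa only [hkernel, mul_neg, integral_neg, neg_inj, mul_comm] using hparts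

theorem lintegral_sq_integral_kernel_le {k : Heis n → ℝ} (hk : Continuous k)
    (hk1 : ∫⁻ p, ‖k p‖ₑ = 1) {H : Heis n → Heis n → ℝ} (hH : Measurable (Function.uncurry H)) :
    ∫⁻ x, ‖∫ p, k p * H p x‖ₑ ^ 2 ≤ ∫⁻ p, ‖k p‖ₑ * ∫⁻ x, ‖H p x‖ₑ ^ 2 := by
  have hkm : Measurable fun p => ‖k p‖ₑ := hk.enorm.measurable
  let κ : Measure (Heis n) := volume.withDensity fun p => ‖k p‖ₑ
  have hκ : IsProbabilityMeasure κ := ⟨by simpa [κ] using hk1⟩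
  have hHx : ∀ x, Measurable fun p => ‖H p x‖ₑ := fun x =>
    (hH.comp (measurable_id.prodMk measurable_const)).enorm
  have hjensen : ∀ x, ‖∫ p, k p * H p x‖ₑ ^ 2 ≤ ∫⁻ p, ‖H p x‖ₑ ^ 2 ∂κ := fun x => by
    refine le_trans ?_ (sq_lintegral_le_lintegral_sq κ (hHx x).aemeasurable)
    rw [lintegral_withDensity_eq_lintegral_mul _ hkm (hHx x)]
    gcongr
    exact (enorm_integral_le_lintegral_enorm _).trans_eq (by simp only [enorm_mul, Pi.mul_apply])
  calc ∫⁻ x, ‖∫ p, k p * H p x‖ₑ ^ 2 ≤ ∫⁻ x, ∫⁻ p, ‖H p x‖ₑ ^ 2 ∂κ := lintegral_mono hjensen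
    _ = ∫⁻ p, (∫⁻ x, ‖H p x‖ₑ ^ 2) ∂κ :=
        lintegral_lintegral_swap ((hH.comp measurable_swap).enorm.pow_const 2).aemeasurable
    _ = ∫⁻ p, ‖k p‖ₑ * ∫⁻ x, ‖H p x‖ₑ ^ 2 :=
        lintegral_withDensity_eq_lintegral_mul _ hkm (hH.enorm.pow_const 2).lintegral_prod_right

theorem lintegral_sq_hconv_le {k g : Heis n → ℝ} (hk : Continuous k)
    (hk1 : ∫⁻ p, ‖k p‖ₑ = 1) (hg : AEStronglyMeasurable g) :
    ∫⁻ x, ‖hconv k g x‖ₑ ^ 2 ≤ ∫⁻ x, ‖g x‖ₑ ^ 2 := by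
  have hae := hg.ae_eq_mk
  set g' := hg.mk g
  have hm : Measurable g' := hg.stronglyMeasurable_mk.measurable
  calc ∫⁻ x, ‖hconv k g x‖ₑ ^ 2 = ∫⁻ x, ‖∫ p, k p * g' (hmul (-p) x)‖ₑ ^ 2 := by
        rw [hconv_congr_ae hae]
        simp only [hconv_eq_integral_translate]
    _ ≤ ∫⁻ p, ‖k p‖ₑ * ∫⁻ x, ‖g' (hmul (-p) x)‖ₑ ^ 2 :=
        lintegral_sq_integral_kernel_le hk hk1 (H := fun p x => g' (hmul (-p) x))
          (hm.comp (measurable_hmul measurable_fst.neg measurable_snd))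
    _ = ∫⁻ x, ‖g' x‖ₑ ^ 2 := by
        simp only [lintegral_hmul_left fun x => ‖g' x‖ₑ ^ 2]
        rw [lintegral_mul_const _ hk.enorm.measurable, hk1, one_mul]
    _ = ∫⁻ x, ‖g x‖ₑ ^ 2 := lintegral_congr_ae (hae.mono fun x hx => by simp only [hx])

theorem tendsto_eLpNorm_left_translate {v : Heis n → ℝ} (hv : MemLp v 2) :
    Tendsto (fun p : Heis n => eLpNorm (fun x => v (hmul (-p) x) - v x) 2 volume) (𝓝 0) (𝓝 0) := by
  let G : C(Heis n, C(Heis n, Heis n)) :=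
    (ContinuousMap.mk (fun a : Heis n × Heis n => hmul (-a.1) a.2) (by fun_prop)).curry
  have hG : ∀ p, MeasurePreserving (G p) := fun p => measurePreserving_hmul_left (-p)
  have hcont : Continuous fun p => Lp.compMeasurePreserving (G p) (hG p) hv.toLp :=
    continuous_const.compMeasurePreservingLp G.continuous hG (by simp)
  have hzero : Lp.compMeasurePreserving (G 0) (hG 0) hv.toLp = hv.toLp := by
    rw [Lp.toLp_compMeasurePreserving]
    exact MemLp.toLp_congr _ _ (Eventually.of_forall fun x => by simp [G])
  have hdiff := (continuous_enorm.tendsto _).comp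
    ((hcont.tendsto 0).sub (tendsto_const_nhds (x := hv.toLp)))
  rw [hzero, sub_self, enorm_zero] at hdiff
  refine hdiff.congr fun p => ?_
  rw [Function.comp_apply, Lp.toLp_compMeasurePreserving, ← MemLp.toLp_sub, Lp.enorm_toLp]
  rfl

/-- A smooth bump at the origin supported in the ball of radius `1 / (m + 1)`. -/
noncomputable def originBump (n m : ℕ) : ContDiffBump (0 : Heis n) :=
  ⟨1 / (m + 1) / 2, 1 / (m + 1), by positivity, half_lt_self (by positivity)⟩

/-- The `m`-th mollifier: `originBump` normalized to have integral one. -/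
noncomputable def mollifier (n m : ℕ) : Heis n → ℝ := (originBump n m).normed volume

theorem contDiff_mollifier (n m : ℕ) : ContDiff ℝ ∞ (mollifier n m) :=
  (originBump n m).contDiff_normed

theorem hasCompactSupport_mollifier (n m : ℕ) : HasCompactSupport (mollifier n m) :=
  (originBump n m).hasCompactSupport_normed

theorem integral_mollifier (n m : ℕ) : ∫ p, mollifier n m p = 1 :=
  (originBump n m).integral_normed

theorem integrable_mollifier (n m : ℕ) : Integrable (mollifier n m) :=
  (originBump n m).integrable_normed

theorem lintegral_mollifier (n m : ℕ) : ∫⁻ p, ‖mollifier n m p‖ₑ = 1 := by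
  have hnonneg : ∀ p, 0 ≤ mollifier n m p := (originBump n m).nonneg_normed
  have h := ofReal_integral_eq_lintegral_ofReal (integrable_mollifier n m)
    (Eventually.of_forall hnonneg)
  rw [integral_mollifier, ENNReal.ofReal_one] at h
  rw [h]
  exact lintegral_congr fun p => Real.enorm_eq_ofReal (hnonneg p)

theorem mollifier_eq_zero {m : ℕ} {p : Heis n} (hp : 1 / ((m : ℝ) + 1) ≤ ‖p‖) :
    mollifier n m p = 0 := by
  rw [← Function.notMem_support, mollifier, ContDiffBump.support_normed_eq, mem_ball_zero_iff]
  exact not_lt.2 hp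

theorem hconv_mollifier_sub {v : Heis n → ℝ} (hv : Integrable v) (m : ℕ) (x : Heis n) :
    (hconv (mollifier n m) v - v) x = ∫ p, mollifier n m p * (v (hmul (-p) x) - v x) := by
  have hk := (contDiff_mollifier n m).continuous
  obtain ⟨B, hB⟩ := (hasCompactSupport_mollifier n m).exists_bound_of_continuous hk
  have hi : Integrable fun p => mollifier n m p * v (hmul (-p) x) :=
    (((measurePreserving_neg_hmul x).integrable_comp_emb
      (measurableEmbedding_neg_hmul x)).2 hv).bdd_mul hk.aestronglyMeasurable
      (Eventually.of_forall hB)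
  simp only [mul_sub]
  rw [integral_sub hi ((integrable_mollifier n m).mul_const _), integral_mul_const,
    integral_mollifier, one_mul, ← hconv_eq_integral_translate, Pi.sub_apply]

theorem eLpNorm_hconv_mollifier_sub_le {v : Heis n → ℝ} (hm : Measurable v) (hv : Integrable v)
    {m : ℕ} {ε : ℝ≥0∞} (hε : ∀ p : Heis n, ‖p‖ < 1 / ((m : ℝ) + 1) →
      eLpNorm (fun x => v (hmul (-p) x) - v x) 2 volume ≤ ε) :
    eLpNorm (hconv (mollifier n m) v - v) 2 volume ≤ ε := by
  have hk := (contDiff_mollifier n m).continuous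
  rw [← ENNReal.pow_le_pow_left_iff two_ne_zero, eLpNorm_two_sq]
  calc ∫⁻ x, ‖(hconv (mollifier n m) v - v) x‖ₑ ^ 2
      = ∫⁻ x, ‖∫ p, mollifier n m p * (v (hmul (-p) x) - v x)‖ₑ ^ 2 := by
        simp only [hconv_mollifier_sub hv]
    _ ≤ ∫⁻ p, ‖mollifier n m p‖ₑ * ∫⁻ x, ‖v (hmul (-p) x) - v x‖ₑ ^ 2 :=
        lintegral_sq_integral_kernel_le hk (lintegral_mollifier n m)
          (H := fun p x => v (hmul (-p) x) - v x)
          ((hm.comp (measurable_hmul measurable_fst.neg measurable_snd)).sub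
            (hm.comp measurable_snd))
    _ ≤ ∫⁻ p, ‖mollifier n m p‖ₑ * ε ^ 2 := by
        refine lintegral_mono fun p => ?_
        rcases le_or_gt (1 / ((m : ℝ) + 1)) ‖p‖ with hp | hp
        · simp [mollifier_eq_zero hp]
        · rw [← eLpNorm_two_sq]
          gcongr
          exact hε p hp
    _ = ε ^ 2 := by
        rw [lintegral_mul_const _ hk.enorm.measurable, lintegral_mollifier, one_mul]

theorem tendsto_eLpNorm_hconv_mollifier_sub {v : Heis n → ℝ} (hv : MemLp v 2)
    (hvi : Integrable v) :
    Tendsto (fun m => eLpNorm (hconv (mollifier n m) v - v) 2 volume) atTop (𝓝 0) := by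
  have hae := hv.aestronglyMeasurable.ae_eq_mk
  have hmk : ∀ m, eLpNorm (hconv (mollifier n m) v - v) 2 volume =
      eLpNorm (hconv (mollifier n m) (hv.aestronglyMeasurable.mk v) -
        hv.aestronglyMeasurable.mk v) 2 volume := fun m => by
    rw [hconv_congr_ae hae]
    exact eLpNorm_congr_ae ((EventuallyEq.refl _ _).sub hae)
  simp only [hmk]
  rw [ENNReal.tendsto_nhds_zero]
  intro ε hε
  obtain ⟨δ, hδ, hball⟩ := Metric.eventually_nhds_iff_ball.1 (ENNReal.tendsto_nhds_zero.1
    (tendsto_eLpNorm_left_translate ((memLp_congr_ae hae).1 hv)) ε hε)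
  filter_upwards [tendsto_one_div_add_atTop_nhds_zero_nat.eventually_lt_const hδ] with m hm
  exact eLpNorm_hconv_mollifier_sub_le
    hv.aestronglyMeasurable.stronglyMeasurable_mk.measurable (hvi.congr hae) fun p hp =>
      hball p (mem_ball_zero_iff.2 (hp.trans hm))

theorem lintegral_enorm_rpow_le_of_tendsto_eLpNorm {α : Type*} [MeasurableSpace α]
    {μ : Measure α} {p : ℝ≥0∞} (hp : p ≠ 0) {f : ℕ → α → ℝ} {v : α → ℝ}
    (hf : ∀ m, AEStronglyMeasurable (f m) μ) (hv : AEStronglyMeasurable v μ)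
    (hlim : Tendsto (fun m => eLpNorm (f m - v) p μ) atTop (𝓝 0)) {q : ℝ} {B : ℝ≥0∞}
    (hB : ∀ m, ∫⁻ x, ‖f m x‖ₑ ^ q ∂μ ≤ B) : ∫⁻ x, ‖v x‖ₑ ^ q ∂μ ≤ B := by
  obtain ⟨ns, -, hns⟩ :=
    (tendstoInMeasure_of_tendsto_eLpNorm hp hf hv hlim).exists_seq_tendsto_ae
  calc ∫⁻ x, ‖v x‖ₑ ^ q ∂μ = ∫⁻ x, liminf (fun i => ‖f (ns i) x‖ₑ ^ q) atTop ∂μ := by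
        refine lintegral_congr_ae (hns.mono fun x hx => ?_)
        exact (((ENNReal.continuous_rpow_const (y := q)).tendsto _).comp
          ((continuous_enorm.tendsto _).comp hx)).liminf_eq.symm
    _ ≤ liminf (fun i => ∫⁻ x, ‖f (ns i) x‖ₑ ^ q ∂μ) atTop :=
        lintegral_liminf_le' fun i => (hf (ns i)).enorm.pow_const _
    _ ≤ B := liminf_le_of_le (by isBoundedDefault) fun b hb =>
        let ⟨i, hi⟩ := hb.exists
        hi.trans (hB (ns i))

theorem lintegral_horizontalGradSq_hconv_le {k v : Heis n → ℝ} {g : Fin n ⊕ Fin n → Heis n → ℝ}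
    (hk : ContDiff ℝ ∞ k) (hkc : HasCompactSupport k) (hk1 : ∫⁻ p, ‖k p‖ₑ = 1)
    (hv : Integrable v) (hvc : HasCompactSupport v) (hg : ∀ j, IsWeakFrameDeriv univ j v (g j)) :
    ∫⁻ x, horizontalGradSq (hconv k v) x ≤ ∑ j, ∫⁻ x, ‖g j x‖ₑ ^ 2 := by
  have hsmooth : ContDiff ℝ 1 (hconv k v) :=
    (contDiff_hconv hk hkc hv.locallyIntegrable).of_le (by simp)
  calc ∫⁻ x, horizontalGradSq (hconv k v) x
      = ∑ j, ∫⁻ x, ‖frameDeriv j (hconv k v) x‖ₑ ^ 2 :=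
        lintegral_finsetSum _ fun j _ =>
          (continuous_frameDeriv hsmooth j).enorm.measurable.pow_const 2
    _ ≤ ∑ j, ∫⁻ x, ‖g j x‖ₑ ^ 2 := Finset.sum_le_sum fun j _ => by
        rw [frameDeriv_hconv hk hkc hv hvc (hg j)]
        exact lintegral_sq_hconv_le hk.continuous hk1 (locallyIntegrableOn_univ.1
          ((hg j).1.locallyIntegrableOn isOpen_univ)).aestronglyMeasurable

theorem sobolev_weak (hn : 1 ≤ n) :
    ∃ C : ℝ, 0 < C ∧ ∀ (v : Heis n → ℝ) (g : Fin n ⊕ Fin n → Heis n → ℝ), HasCompactSupport v →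
      MemLp v 2 → (∀ j, IsWeakFrameDeriv univ j v (g j)) →
      (∫⁻ x, ‖v x‖ₑ ^ sobExp n) ^ (2 / sobExp n) ≤
        ENNReal.ofReal C * ∑ j, ∫⁻ x, ‖g j x‖ₑ ^ 2 := by
  obtain ⟨C, hC, hsob⟩ := sobolev_contDiff hn
  refine ⟨C, hC, fun v g hvc hv hg => ?_⟩
  have hq := sobExp_pos hn
  have hvi : Integrable v :=
    (integrableOn_iff_integrable_of_support_subset (subset_tsupport v)).1
      ((hv.locallyIntegrable one_le_two).integrableOn_isCompact hvc)
  have hk := contDiff_mollifier n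
  have hkc := hasCompactSupport_mollifier n
  have hsmooth m := contDiff_hconv (hk m) (hkc m) hvi.locallyIntegrable
  have hinv : 2 / sobExp n = (sobExp n / 2)⁻¹ := (inv_div _ _).symm
  rw [hinv, ENNReal.rpow_inv_le_iff (by positivity)]
  refine lintegral_enorm_rpow_le_of_tendsto_eLpNorm two_ne_zero
    (fun m => (hsmooth m).continuous.aestronglyMeasurable) hv.1
    (tendsto_eLpNorm_hconv_mollifier_sub hv hvi) fun m => ?_
  rw [← ENNReal.rpow_inv_le_iff (by positivity), ← hinv]
  refine (hsob _ ((hsmooth m).of_le (by simp)) (hasCompactSupport_hconv (hkc m) hvc)).trans ?_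
  gcongr
  exact lintegral_horizontalGradSq_hconv_le (hk m) (hkc m) (lintegral_mollifier n m) hvi hvc hg

/-! ### Logarithmic cutoffs -/

theorem frameDeriv_comp_dilation {φ : Heis n → ℝ} (hφ : Differentiable ℝ φ) (r : ℝ)
    (j : Fin n ⊕ Fin n) (p : Heis n) :
    frameDeriv j (fun x => φ (dilation r x)) p = r * frameDeriv j φ (dilation r p) := by
  have hline : ∀ s : ℝ, dilation r (hmul p (s • frameDir j, 0)) =
      hmul (dilation r p) ((r * s) • frameDir j, 0) := by
    intro s
    simp only [dilation_eq_smul, hmul, smul_add, smul_smul, smul_eq_mul, sympl_smul_left,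
      sympl_smul_right]
    ring_nf
  have hcomp := hasDerivAt_frame_line (f := fun x => φ (dilation r x))
    (hφ.comp ((contDiff_dilation r (k := 1)).differentiable one_ne_zero)) j p
  simp only [hline] at hcomp
  have hdil : HasDerivAt (fun s : ℝ => φ (hmul (dilation r p) (s • frameDir j, 0)))
      (frameDeriv j φ (dilation r p)) (r * 0) := by
    simpa using hasDerivAt_frame_line hφ j (dilation r p)
  rw [hcomp.unique (hdil.comp 0 ((hasDerivAt_id (0 : ℝ)).const_mul r))]
  ring

theorem exists_abs_le_mul_homNorm_pow {f : Heis n → ℝ} (hf : Continuous f) {k : ℕ}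
    (hhom : ∀ r : ℝ, 0 < r → ∀ p, f (dilation r p) = r ^ k * f p) :
    ∃ C : ℝ, ∀ p, p ≠ 0 → |f p| ≤ C * homNorm p ^ k := by
  obtain ⟨C, hC⟩ := (isCompact_homBall (n := n) 1).exists_bound_of_continuousOn hf.continuousOn
  refine ⟨C, fun p hp => ?_⟩
  have hN := homNorm_pos hp
  have hunit : dilation (homNorm p)⁻¹ p ∈ homBall n 1 := by
    simp [homBall, homNorm_dilation (inv_pos.2 hN), hN.ne']
  have hp' : p = dilation (homNorm p) (dilation (homNorm p)⁻¹ p) := by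
    rw [dilation_dilation, mul_inv_cancel₀ hN.ne', dilation_one]
  rw [hp', hhom _ hN, ← hp', abs_mul, abs_of_pos (pow_pos hN k), mul_comm]
  gcongr
  exact hC _ hunit

theorem koranyiPoly_dilation {r : ℝ} (hr : 0 < r) (p : Heis n) :
    koranyiPoly (dilation r p) = r ^ 4 * koranyiPoly p := by
  rw [← homNorm_pow_four, homNorm_dilation hr, mul_pow, homNorm_pow_four]

theorem frameDeriv_koranyiPoly_dilation {r : ℝ} (hr : 0 < r) (j : Fin n ⊕ Fin n) (p : Heis n) :
    frameDeriv j koranyiPoly (dilation r p) = r ^ 3 * frameDeriv j koranyiPoly p := by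
  have hdiff : Differentiable ℝ (koranyiPoly : Heis n → ℝ) :=
    (contDiff_koranyiPoly (k := 1)).differentiable one_ne_zero
  have hcomp := frameDeriv_comp_dilation hdiff r j p
  simp only [koranyiPoly_dilation hr] at hcomp
  rw [frameDeriv_comp (g := fun s => r ^ 4 * s) ((hasDerivAt_id _).const_mul _) (hdiff p)] at hcomp
  refine mul_left_cancel₀ hr.ne' ?_
  linear_combination -hcomp

theorem exists_abs_frameDeriv_koranyiPoly_le (n : ℕ) :
    ∃ C : ℝ, 0 < C ∧ ∀ (j : Fin n ⊕ Fin n) (p : Heis n), p ≠ 0 →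
      |frameDeriv j koranyiPoly p| ≤ C * homNorm p ^ 3 := by
  choose C hC using fun j : Fin n ⊕ Fin n =>
    exists_abs_le_mul_homNorm_pow (continuous_frameDeriv contDiff_koranyiPoly j)
      fun r hr p => frameDeriv_koranyiPoly_dilation hr j p
  obtain ⟨M, hM⟩ := Finite.bddAbove_range C
  refine ⟨max M 1, by positivity, fun j p hp => (hC j p hp).trans ?_⟩
  have := homNorm_nonneg p
  gcongr
  exact (hM (mem_range_self j)).trans (le_max_left _ _)

/-- The profile of the logarithmic cutoffs, equal to `1` on `[1, 2]` and supported in `[0, 3]`. -/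
noncomputable def logBump : ContDiffBump (3 / 2 : ℝ) := ⟨1 / 2, 3 / 2, by norm_num, by norm_num⟩

/-- The logarithmic cutoff, equal to `1` on `{R ≤ |x| ≤ R²}` and supported in `{1 ≤ |x| ≤ R³}`.
At the origin it vanishes because `Real.log 0 = 0`. -/
noncomputable def logCutoff (R : ℝ) (p : Heis n) : ℝ :=
  logBump (Real.log (homNorm p) / Real.log R)

theorem logCutoff_eq_logBump_log_koranyiPoly (R : ℝ) (p : Heis n) :
    logCutoff R p = logBump (Real.log (koranyiPoly p) / (4 * Real.log R)) := by
  rw [logCutoff, ← homNorm_pow_four, Real.log_pow, Nat.cast_ofNat,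
    mul_div_mul_left _ _ four_ne_zero]

theorem logCutoff_nonneg (R : ℝ) (p : Heis n) : 0 ≤ logCutoff R p := logBump.nonneg

theorem logCutoff_le_one (R : ℝ) (p : Heis n) : logCutoff R p ≤ 1 := logBump.le_one

theorem logCutoff_eq_zero {R : ℝ} (hR : 1 < R) {p : Heis n}
    (hp : homNorm p ≤ 1 ∨ R ^ 3 ≤ homNorm p) : logCutoff R p = 0 := by
  have hlog := Real.log_pos hR
  refine logBump.zero_of_le_dist ?_
  simp only [logBump, Real.dist_eq, le_abs']
  rcases hp with hp | hp
  · left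
    have : Real.log (homNorm p) / Real.log R ≤ 0 :=
      div_nonpos_of_nonpos_of_nonneg (Real.log_nonpos (homNorm_nonneg p) hp) hlog.le
    linarith
  · right
    have : 3 ≤ Real.log (homNorm p) / Real.log R := by
      rw [le_div_iff₀ hlog]
      simpa [Real.log_pow] using Real.log_le_log (by positivity) hp
    linarith

theorem logCutoff_eq_one {R : ℝ} (hR : 1 < R) {p : Heis n} (hp : R ≤ homNorm p)
    (hp' : homNorm p ≤ R ^ 2) : logCutoff R p = 1 := by
  have hlog := Real.log_pos hR
  have hlower : 1 ≤ Real.log (homNorm p) / Real.log R :=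
    (one_le_div hlog).2 (Real.log_le_log (by positivity) hp)
  have hupper : Real.log (homNorm p) / Real.log R ≤ 2 := by
    rw [div_le_iff₀ hlog]
    simpa [Real.log_pow] using Real.log_le_log (by linarith) hp'
  refine logBump.one_of_mem_closedBall ?_
  simp only [logBump, Metric.mem_closedBall, Real.dist_eq, abs_le]
  constructor <;> linarith

theorem contDiff_logCutoff {R : ℝ} (hR : 1 < R) : ContDiff ℝ ∞ (logCutoff R : Heis n → ℝ) := by
  refine contDiff_iff_contDiffAt.2 fun p => ?_
  by_cases hp : p = 0
  · have hball : ∀ᶠ x in 𝓝 p, homNorm x < 1 :=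
      continuous_homNorm.tendsto p (Iio_mem_nhds (by simp [homNorm_eq_zero_iff.2 hp]))
    exact (contDiffAt_const (c := 0)).congr_of_eventuallyEq
      (hball.mono fun x hx => logCutoff_eq_zero hR (Or.inl hx.le))
  · rw [funext (logCutoff_eq_logBump_log_koranyiPoly (n := n) R)]
    exact logBump.contDiffAt.comp p
      ((contDiff_koranyiPoly.contDiffAt.log (koranyiPoly_pos hp).ne').div_const _)

theorem isCompact_annulus (T : ℝ) : IsCompact (annulus n T) :=
  (isCompact_homBall T).of_isClosed_subset
    ((isClosed_le continuous_const continuous_homNorm).inter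
      (isClosed_le continuous_homNorm continuous_const)) fun _ hp => hp.2

theorem annulus_subset_compl_zero (T : ℝ) : annulus n T ⊆ {0}ᶜ := by
  rintro p hp rfl
  have hle : (1 : ℝ) ≤ homNorm (0 : Heis n) := hp.1
  rw [homNorm_eq_zero_iff.2 rfl] at hle
  exact one_pos.not_ge hle

theorem tsupport_logCutoff_subset {R : ℝ} (hR : 1 < R) :
    tsupport (logCutoff R : Heis n → ℝ) ⊆ annulus n (R ^ 3) := by
  refine closure_minimal (fun p hp => ?_) (isCompact_annulus _).isClosed
  contrapose! hp
  refine Function.notMem_support.2 (logCutoff_eq_zero hR ?_)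
  by_contra! h
  exact hp ⟨h.1.le, h.2.le⟩

theorem hasCompactSupport_logCutoff {R : ℝ} (hR : 1 < R) :
    HasCompactSupport (logCutoff R : Heis n → ℝ) :=
  (isCompact_annulus _).of_isClosed_subset (isClosed_tsupport _) (tsupport_logCutoff_subset hR)

theorem frameDeriv_logCutoff_eq_zero {R : ℝ} (hR : 1 < R) (j : Fin n ⊕ Fin n) {p : Heis n}
    (hp : homNorm p ≤ 1 ∨ R ^ 3 ≤ homNorm p) : frameDeriv j (logCutoff R) p = 0 := by
  have hmin : IsLocalMin (logCutoff R) p := Eventually.of_forall fun x =>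
    (logCutoff_eq_zero hR hp).trans_le (logCutoff_nonneg R x)
  rw [frameDeriv, hmin.fderiv_eq_zero, zero_apply]

theorem exists_abs_frameDeriv_logCutoff_le (n : ℕ) :
    ∃ B : ℝ, 0 < B ∧ ∀ R : ℝ, 1 < R → ∀ (j : Fin n ⊕ Fin n) (p : Heis n), p ≠ 0 →
      |frameDeriv j (logCutoff R) p| ≤ B / (Real.log R * homNorm p) := by
  have hsmooth : ContDiff ℝ 1 logBump := logBump.contDiff
  obtain ⟨D, hD⟩ := logBump.hasCompactSupport.deriv.exists_bound_of_continuous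
    (hsmooth.continuous_deriv le_rfl)
  obtain ⟨C, hC, hpoly⟩ := exists_abs_frameDeriv_koranyiPoly_le n
  have hD0 : 0 ≤ D := (norm_nonneg _).trans (hD 0)
  refine ⟨(D + 1) * C / 4, by positivity, fun R hR j p hp => ?_⟩
  have hlog := Real.log_pos hR
  have hN := homNorm_pos hp
  set a := Real.log (koranyiPoly p) / (4 * Real.log R)
  have hchain : frameDeriv j (logCutoff R) p =
      deriv logBump a * ((koranyiPoly p)⁻¹ / (4 * Real.log R)) * frameDeriv j koranyiPoly p := by
    rw [funext (logCutoff_eq_logBump_log_koranyiPoly (n := n) R)]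
    refine frameDeriv_comp (g := fun s => logBump (Real.log s / (4 * Real.log R))) ?_
      ((contDiff_koranyiPoly (k := 1)).differentiable one_ne_zero p) j
    exact HasDerivAt.comp (h₂ := logBump) _ (hsmooth.differentiable one_ne_zero a).hasDerivAt
      ((Real.hasDerivAt_log (koranyiPoly_pos hp).ne').div_const _)
  rw [hchain, ← homNorm_pow_four, abs_mul, abs_mul,
    abs_of_pos (show 0 < (homNorm p ^ 4)⁻¹ / (4 * Real.log R) by positivity)]
  calc |deriv logBump a| * ((homNorm p ^ 4)⁻¹ / (4 * Real.log R)) * |frameDeriv j koranyiPoly p|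
      ≤ (D + 1) * ((homNorm p ^ 4)⁻¹ / (4 * Real.log R)) * (C * homNorm p ^ 3) := by
        gcongr
        · exact (hD a).trans (le_add_of_nonneg_right zero_le_one)
        · exact hpoly j p hp
    _ = (D + 1) * C / 4 / (Real.log R * homNorm p) := by field_simp

/-! ### Weak derivatives under dilations and cutoffs -/

theorem IsWeakFrameDeriv.const_mul {U : Set (Heis n)} {j : Fin n ⊕ Fin n} {u g : Heis n → ℝ}
    (hg : IsWeakFrameDeriv U j u g) (c : ℝ) :
    IsWeakFrameDeriv U j (fun p => c * u p) fun p => c * g p := by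
  refine ⟨fun K hK hKU => (hg.1 K hK hKU).const_mul c, fun φ hφ hφc hφU => ?_⟩
  simp only [mul_assoc, integral_const_mul, hg.2 φ hφ hφc hφU, mul_neg]

theorem IsWeakFrameDeriv.congr_ae {U : Set (Heis n)} {j : Fin n ⊕ Fin n} {u v g : Heis n → ℝ}
    (hg : IsWeakFrameDeriv U j u g) (huv : u =ᵐ[volume] v) : IsWeakFrameDeriv U j v g :=
  ⟨hg.1, fun φ hφ hφc hφU => (hg.2 φ hφ hφc hφU).symm ▸
    integral_congr_ae (huv.mono fun p hp => by simp only [hp])⟩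

theorem MemL2loc.comp_dilation {U : Set (Heis n)} {g : Heis n → ℝ} (hg : MemL2loc U g) {r : ℝ}
    (hr : 0 < r) : MemL2loc (dilation r ⁻¹' U) fun p => g (dilation r p) := by
  intro K hK hKU
  have hemb : MeasurableEmbedding (dilation r : Heis n → Heis n) :=
    (dilationHomeomorph r hr.ne').measurableEmbedding
  have hmap : Measure.map (dilation r) (volume.restrict K) =
      ENNReal.ofReal (r ^ homDim n)⁻¹ • volume.restrict (dilation r '' K) := by
    rw [← Measure.restrict_smul, ← map_dilation hr, hemb.restrict_map,
      preimage_image_eq _ hemb.injective]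
  refine hemb.memLp_map_measure_iff.1 (hmap ▸ MemLp.smul_measure ?_ ENNReal.ofReal_ne_top)
  exact hg _ (hK.image (contDiff_dilation r (k := 0)).continuous) (image_subset_iff.2 hKU)

theorem IsWeakFrameDeriv.comp_dilation {U : Set (Heis n)} {j : Fin n ⊕ Fin n} {u g : Heis n → ℝ}
    (hg : IsWeakFrameDeriv U j u g) {r : ℝ} (hr : 0 < r) :
    IsWeakFrameDeriv (dilation r ⁻¹' U) j (fun p => u (dilation r p))
      fun p => r * g (dilation r p) := by
  refine ⟨fun K hK hKU => (hg.1.comp_dilation hr K hK hKU).const_mul r,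
    fun φ hφ hφc hφU => ?_⟩
  let ψ : Heis n → ℝ := fun p => φ (dilation r⁻¹ p)
  have hcancel (s t : ℝ) (hst : s * t = 1) (p : Heis n) : dilation s (dilation t p) = p := by
    rw [dilation_dilation, hst, dilation_one]
  have hφψ : φ = fun p => ψ (dilation r p) :=
    funext fun p => by simp only [ψ, hcancel _ _ (inv_mul_cancel₀ hr.ne')]
  have hψ : ContDiff ℝ ∞ ψ := hφ.comp (contDiff_dilation r⁻¹)
  have hψc : HasCompactSupport ψ :=
    hφc.comp_homeomorph (dilationHomeomorph r⁻¹ (inv_ne_zero hr.ne'))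
  have hψU : tsupport ψ ⊆ U := fun p hp => by
    have hmem := hφU (tsupport_comp_subset_preimage φ
      (contDiff_dilation r⁻¹ (k := 0)).continuous hp)
    rwa [mem_preimage, hcancel _ _ (mul_inv_cancel₀ hr.ne')] at hmem
  have hderiv : ∀ p, frameDeriv j φ p = r * frameDeriv j ψ (dilation r p) := fun p => by
    rw [← frameDeriv_comp_dilation (hψ.differentiable (by simp)), ← hφψ]
  calc ∫ p, u (dilation r p) * frameDeriv j φ p
      = r * ∫ p, u (dilation r p) * frameDeriv j ψ (dilation r p) := by
        simp only [hderiv, mul_left_comm _ r, integral_const_mul]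
    _ = r * -∫ p, g (dilation r p) * ψ (dilation r p) := by
        rw [integral_dilation hr fun p => u p * frameDeriv j ψ p, hg.2 ψ hψ hψc hψU,
          integral_dilation hr fun p => g p * ψ p, mul_neg]
    _ = -∫ p, r * g (dilation r p) * φ p := by
        rw [hφψ]
        simp only [mul_assoc, integral_const_mul, mul_neg]

theorem preimage_dilation_compl_zero {r : ℝ} (hr : 0 < r) :
    dilation r ⁻¹' ({0}ᶜ : Set (Heis n)) = {0}ᶜ := by
  ext p
  simp [← homNorm_eq_zero_iff, homNorm_dilation hr, hr.ne']

theorem IsWeakFrameDeriv.ae_comp_dilation_eq {j : Fin n ⊕ Fin n} {u g : Heis n → ℝ}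
    (hg : IsWeakFrameDeriv {0}ᶜ j u g) {r c : ℝ} (hr : 0 < r)
    (hu : ∀ᵐ p : Heis n, u (dilation r p) = c * u p) :
    ∀ᵐ p : Heis n, g (dilation r p) = c * r⁻¹ * g p := by
  have hdil := (hg.comp_dilation hr).congr_ae hu
  rw [preimage_dilation_compl_zero hr] at hdil
  filter_upwards [hdil.ae_eq isOpen_compl_singleton (hg.const_mul c),
    compl_mem_ae_iff.2 (measure_singleton 0)] with p hp hp0
  have := hp hp0
  field_simp
  linarith

theorem MemL2loc.integrable_mul {U : Set (Heis n)} {f ψ : Heis n → ℝ} (hf : MemL2loc U f)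
    (hU : IsOpen U) (hψ : Continuous ψ) (hψc : HasCompactSupport ψ) (hψU : tsupport ψ ⊆ U) :
    Integrable fun p => f p * ψ p := by
  have hloc : IntegrableOn f (tsupport ψ) :=
    (hf.locallyIntegrableOn hU).integrableOn_compact_subset hψU hψc
  refine (integrableOn_iff_integrable_of_support_subset ?_).1
    (hloc.mul_continuousOn hψ.continuousOn hψc)
  exact (Function.support_mul_subset_right f ψ).trans (subset_tsupport ψ)

theorem MemL2loc.memLp_mul {U : Set (Heis n)} {f ψ : Heis n → ℝ} (hf : MemL2loc U f)
    (hψ : Continuous ψ) (hψc : HasCompactSupport ψ) (hψU : tsupport ψ ⊆ U) :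
    MemLp (fun p => ψ p * f p) 2 := by
  obtain ⟨C, hC⟩ := hψc.exists_bound_of_continuous hψ
  have hmem : MemLp (fun p => ψ p * f p) 2 (volume.restrict (tsupport ψ)) :=
    (hf _ hψc hψU).of_le_mul (hψ.aestronglyMeasurable.mul (hf _ hψc hψU).1)
      (Eventually.of_forall fun p => by
        rw [norm_mul]
        gcongr
        exact hC p)
  rw [← memLp_indicator_iff_restrict (isClosed_tsupport ψ).measurableSet] at hmem
  rwa [indicator_eq_self.2 ((Function.support_mul_subset_left ψ f).trans (subset_tsupport ψ))]
    at hmem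

theorem frameDeriv_mul {f h : Heis n → ℝ} (hf : Differentiable ℝ f) (hh : Differentiable ℝ h)
    (j : Fin n ⊕ Fin n) (p : Heis n) :
    frameDeriv j (fun x => f x * h x) p = f p * frameDeriv j h p + h p * frameDeriv j f p := by
  simp [frameDeriv, fderiv_fun_mul (hf p) (hh p)]

theorem tsupport_frameDeriv_subset (j : Fin n ⊕ Fin n) (f : Heis n → ℝ) :
    tsupport (frameDeriv j f) ⊆ tsupport f := by
  refine closure_minimal (fun p hp => ?_) (isClosed_tsupport f)
  contrapose! hp
  have hzero : fderiv ℝ f p = 0 :=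
    image_eq_zero_of_notMem_tsupport fun h => hp (tsupport_fderiv_subset ℝ h)
  simp [frameDeriv, hzero]

/-- The Leibniz rule for the product with a cutoff, which extends the product by zero outside
`U`. -/
theorem IsWeakFrameDeriv.cutoff_mul {U : Set (Heis n)} (hU : IsOpen U) {j : Fin n ⊕ Fin n}
    {u g η : Heis n → ℝ} (hu : MemL2loc U u) (hg : IsWeakFrameDeriv U j u g)
    (hη : ContDiff ℝ ∞ η) (hηc : HasCompactSupport η) (hηU : tsupport η ⊆ U) :
    IsWeakFrameDeriv univ j (fun p => η p * u p)
      fun p => η p * g p + frameDeriv j η p * u p := by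
  have hη' : Continuous (frameDeriv j η) := continuous_frameDeriv (hη.of_le (by simp)) j
  have hη'c : HasCompactSupport (frameDeriv j η) :=
    hηc.of_isClosed_subset (isClosed_tsupport _) (tsupport_frameDeriv_subset j η)
  have hη'U := (tsupport_frameDeriv_subset j η).trans hηU
  refine ⟨fun K _ _ => ((hg.1.memLp_mul hη.continuous hηc hηU).add
    (hu.memLp_mul hη' hη'c hη'U)).restrict K, fun φ hφ _ _ => ?_⟩
  have hφ' : Continuous (frameDeriv j φ) := continuous_frameDeriv (hφ.of_le (by simp)) j
  have huηφ : Integrable fun p => u p * (η p * frameDeriv j φ p) :=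
    hu.integrable_mul hU (hη.continuous.mul hφ') hηc.mul_right
      (tsupport_mul_subset_left.trans hηU)
  have huφη : Integrable fun p => u p * (frameDeriv j η p * φ p) :=
    hu.integrable_mul hU (hη'.mul hφ.continuous) hη'c.mul_right
      (tsupport_mul_subset_left.trans hη'U)
  have hgηφ : Integrable fun p => g p * (η p * φ p) :=
    hg.1.integrable_mul hU (hη.continuous.mul hφ.continuous) hηc.mul_right
      (tsupport_mul_subset_left.trans hηU)
  have htest := hg.2 (fun p => η p * φ p) (hη.mul hφ) hηc.mul_right
    (tsupport_mul_subset_left.trans hηU)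
  simp only [frameDeriv_mul (hη.differentiable (by simp)) (hφ.differentiable (by simp)), mul_add,
    mul_comm (φ _) (frameDeriv _ _ _)] at htest
  rw [integral_add huηφ huφη] at htest
  calc ∫ p, η p * u p * frameDeriv j φ p
      = ∫ p, u p * (η p * frameDeriv j φ p) := by simp only [mul_comm (η _) (u _), mul_assoc]
    _ = -∫ p, (g p * (η p * φ p) + u p * (frameDeriv j η p * φ p)) := by
        rw [integral_add hgηφ huφη]
        linarith
    _ = -∫ p, (η p * g p + frameDeriv j η p * u p) * φ p := by
        simp only [add_mul, mul_comm (η _) (g _), mul_comm (frameDeriv _ _ _) (u _), mul_assoc]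

/-! ### Shells and dilation invariant densities -/

/-- The half-open shell `{a ≤ |x| < b}`. -/
def shell (n : ℕ) (a b : ℝ) : Set (Heis n) := homNorm ⁻¹' Ico a b

theorem measurableSet_shell (a b : ℝ) : MeasurableSet (shell n a b) :=
  continuous_homNorm.measurable measurableSet_Ico

theorem shell_one_subset_annulus (T : ℝ) : shell n 1 T ⊆ annulus n T := fun _ hp => ⟨hp.1, hp.2.le⟩

theorem MemL2loc.memLp_shell {f : Heis n → ℝ} (hf : MemL2loc {0}ᶜ f) (T : ℝ) :
    MemLp f 2 (volume.restrict (shell n 1 T)) :=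
  (hf _ (isCompact_annulus T) (annulus_subset_compl_zero T)).mono_measure
    (Measure.restrict_mono (shell_one_subset_annulus T) le_rfl)

/-- The measure with density `W` is invariant under the dilation `δ_T`, the factor `T^{-Q}` being
the inverse of the Jacobian of `δ_T`. -/
def IsDilationInvariant (T : ℝ) (W : Heis n → ℝ≥0∞) : Prop :=
  ∀ᵐ p : Heis n, W (dilation T p) = ENNReal.ofReal (T ^ homDim n)⁻¹ * W p

theorem isDilationInvariant_enorm_rpow {T : ℝ} (hT : 0 < T) {f : Heis n → ℝ} {s q : ℝ}
    (hq : 0 ≤ q) (hsq : s * q = homDim n) (hf : ∀ᵐ p, f (dilation T p) = T ^ (-s) * f p) :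
    IsDilationInvariant T fun p => ‖f p‖ₑ ^ q := by
  filter_upwards [hf] with p hp
  rw [hp, enorm_mul, ENNReal.mul_rpow_of_nonneg _ _ hq, Real.enorm_of_nonneg (by positivity),
    ENNReal.ofReal_rpow_of_nonneg (by positivity) hq, ← Real.rpow_mul hT.le, neg_mul, hsq,
    Real.rpow_neg hT.le, Real.rpow_natCast]

theorem IsDilationInvariant.sum {ι : Type*} [Fintype ι] {T : ℝ} {W : ι → Heis n → ℝ≥0∞}
    (hW : ∀ i, IsDilationInvariant T (W i)) : IsDilationInvariant T fun p => ∑ i, W i p := by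
  filter_upwards [ae_all_iff.2 hW] with p hp
  rw [Finset.mul_sum, Finset.sum_congr rfl fun i _ => hp i]

theorem preimage_dilation_shell {T : ℝ} (hT : 0 < T) (a b : ℝ) :
    dilation T ⁻¹' shell n (T * a) (T * b) = shell n a b := by
  ext p
  simp [shell, homNorm_dilation hT, hT]

theorem IsDilationInvariant.lintegral_shell_mul {T : ℝ} (hT : 0 < T) {W : Heis n → ℝ≥0∞}
    (hW : IsDilationInvariant T W) (a b : ℝ) :
    ∫⁻ p in shell n (T * a) (T * b), W p = ∫⁻ p in shell n a b, W p := by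
  have hchange := lintegral_dilation hT ((shell n (T * a) (T * b)).indicator W)
  have hpull : ∀ᵐ p : Heis n, (shell n (T * a) (T * b)).indicator W (dilation T p) =
      ENNReal.ofReal (T ^ homDim n)⁻¹ * (shell n a b).indicator W p := by
    filter_upwards [hW] with p hp
    rw [← indicator_comp_right (g := W), preimage_dilation_shell hT]
    by_cases hmem : p ∈ shell n a b
    · simp [hmem, hp]
    · simp [hmem]
  rw [lintegral_congr_ae hpull, lintegral_const_mul' _ _ ENNReal.ofReal_ne_top,
    lintegral_indicator (measurableSet_shell _ _),
    lintegral_indicator (measurableSet_shell _ _)] at hchange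
  exact ((ENNReal.mul_right_inj (by simp [hT]) ENNReal.ofReal_ne_top).1 hchange).symm

theorem IsDilationInvariant.lintegral_shell_pow {T : ℝ} (hT : 1 ≤ T) {W : Heis n → ℝ≥0∞}
    (hW : IsDilationInvariant T W) (a m : ℕ) :
    ∫⁻ p in shell n (T ^ a) (T ^ (a + m)), W p = m * ∫⁻ p in shell n 1 T, W p := by
  have hperiod : ∀ k : ℕ,
      ∫⁻ p in shell n (T ^ k) (T ^ (k + 1)), W p = ∫⁻ p in shell n 1 T, W p := by
    intro k
    induction k with
    | zero => simp
    | succ k ih =>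
      rw [← ih, ← hW.lintegral_shell_mul (by positivity) (T ^ k), ← pow_succ', ← pow_succ']
  induction m with
  | zero => simp [shell]
  | succ m ih =>
    have hunion : shell n (T ^ a) (T ^ (a + (m + 1))) =
        shell n (T ^ a) (T ^ (a + m)) ∪ shell n (T ^ (a + m)) (T ^ (a + m + 1)) := by
      rw [shell, shell, shell, ← preimage_union, Ico_union_Ico_eq_Ico
        (pow_le_pow_right₀ hT (by omega)) (pow_le_pow_right₀ hT (by omega)), add_assoc]
    have hdisj : Disjoint (shell n (T ^ a) (T ^ (a + m)))
        (shell n (T ^ (a + m)) (T ^ (a + m + 1))) :=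
      (Ico_disjoint_Ico_same).preimage _
    rw [hunion, lintegral_union (measurableSet_shell _ _) hdisj, ih, hperiod]
    push_cast
    ring

theorem IsDilationInvariant.lintegral_annulus_le {T : ℝ} (hT : 1 < T) {W : Heis n → ℝ≥0∞}
    (hW : IsDilationInvariant T W) :
    ∫⁻ p in annulus n T, W p ≤ 2 * ∫⁻ p in shell n 1 T, W p := by
  calc ∫⁻ p in annulus n T, W p
      ≤ ∫⁻ p in shell n (T ^ 0) (T ^ (0 + 2)), W p := lintegral_mono_set fun p hp =>
        ⟨by simpa using hp.1, hp.2.trans_lt (lt_self_pow₀ hT (by norm_num))⟩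
    _ = 2 * ∫⁻ p in shell n 1 T, W p := by exact_mod_cast hW.lintegral_shell_pow hT.le 0 2

theorem exists_lintegral_shell_enorm_inv_homNorm_rpow_le (n : ℕ) :
    ∃ J : ℝ, 1 ≤ J ∧ ∀ R : ℝ, 0 < R → 1 ≤ Real.log R →
      ∫⁻ p in shell n 1 (R ^ 3), ‖(homNorm p)⁻¹‖ₑ ^ (homDim n : ℝ) ≤
        ENNReal.ofReal (J * Real.log R) := by
  have hW : IsDilationInvariant (Real.exp 1)
      fun p : Heis n => ‖(homNorm p)⁻¹‖ₑ ^ (homDim n : ℝ) :=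
    isDilationInvariant_enorm_rpow (Real.exp_pos 1) (Nat.cast_nonneg _) (one_mul _)
      (Eventually.of_forall fun p => by
        rw [homNorm_dilation (Real.exp_pos 1), mul_inv, Real.rpow_neg_one])
  set I := ∫⁻ p in shell n 1 (Real.exp 1), ‖(homNorm p)⁻¹‖ₑ ^ (homDim n : ℝ)
  have hfinite : I ≠ ⊤ := by
    have hvol : volume (shell n 1 (Real.exp 1)) < ⊤ :=
      (measure_mono (shell_one_subset_annulus _)).trans_lt (isCompact_annulus _).measure_lt_top
    refine ne_top_of_le_ne_top hvol.ne ?_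
    rw [← setLIntegral_one]
    refine setLIntegral_mono' (measurableSet_shell _ _) fun p hp =>
      ENNReal.rpow_le_one ?_ (Nat.cast_nonneg _)
    rw [Real.enorm_of_nonneg (inv_nonneg.2 (homNorm_nonneg p))]
    exact ENNReal.ofReal_le_one.2 (inv_le_one_of_one_le₀ hp.1)
  refine ⟨4 * I.toReal + 1, by linarith [I.toReal_nonneg], fun R hR hlog => ?_⟩
  have hceil := Nat.ceil_lt_add_one (show 0 ≤ 3 * Real.log R by linarith)
  have hcover : R ^ 3 ≤ Real.exp 1 ^ (0 + ⌈3 * Real.log R⌉₊) := by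
    rw [zero_add, ← Real.exp_nat_mul, mul_one, ← Real.log_le_iff_le_exp (by positivity),
      Real.log_pow]
    exact_mod_cast Nat.le_ceil _
  calc ∫⁻ p in shell n 1 (R ^ 3), ‖(homNorm p)⁻¹‖ₑ ^ (homDim n : ℝ)
      ≤ ∫⁻ p in shell n (Real.exp 1 ^ 0) (Real.exp 1 ^ (0 + ⌈3 * Real.log R⌉₊)),
          ‖(homNorm p)⁻¹‖ₑ ^ (homDim n : ℝ) :=
        lintegral_mono_set fun p hp => ⟨by simpa using hp.1, hp.2.trans_le hcover⟩
    _ = ENNReal.ofReal (⌈3 * Real.log R⌉₊ * I.toReal) := by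
        rw [hW.lintegral_shell_pow (by simp), ENNReal.ofReal_mul (Nat.cast_nonneg _),
          ENNReal.ofReal_natCast, ENNReal.ofReal_toReal hfinite]
    _ ≤ ENNReal.ofReal ((4 * I.toReal + 1) * Real.log R) := by
        refine ENNReal.ofReal_le_ofReal ?_
        nlinarith [I.toReal_nonneg]

theorem two_div_sobExp_lt_one (hn : 1 ≤ n) : 2 / sobExp n < 1 := by
  have hQ := four_le_homDim hn
  rw [two_div_sobExp hn]
  linarith [show 0 < 2 / (homDim n : ℝ) by positivity]

theorem holderConjugate_sobExp_div_two (hn : 1 ≤ n) :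
    (sobExp n / 2).HolderConjugate (homDim n / 2) := by
  have hlt := two_div_sobExp_lt_one hn
  refine Real.holderConjugate_iff.2
    ⟨?_, by rw [inv_div, inv_div, two_div_sobExp hn, sub_add_cancel]⟩
  rw [div_lt_one (sobExp_pos hn)] at hlt
  linarith

theorem ennreal_rpow_le_self_of_one_le {x : ℝ≥0∞} (hx : 1 ≤ x) {s : ℝ} (hs : s ≤ 1) :
    x ^ s ≤ x := by
  simpa using ENNReal.rpow_le_rpow_of_exponent_le hx hs

theorem exists_lintegral_shell_hardy_le (hn : 1 ≤ n) :
    ∃ J : ℝ, 1 ≤ J ∧ ∀ R : ℝ, 0 < R → 1 ≤ Real.log R → ∀ u : Heis n → ℝ,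
      AEStronglyMeasurable u (volume.restrict (shell n 1 (R ^ 3))) →
      ∫⁻ p in shell n 1 (R ^ 3), ‖u p / (Real.log R * homNorm p)‖ₑ ^ 2 ≤
        ENNReal.ofReal (J / Real.log R) *
          (∫⁻ p in shell n 1 (R ^ 3), ‖u p‖ₑ ^ sobExp n) ^ (2 / sobExp n) := by
  obtain ⟨J, hJ, hweight⟩ := exists_lintegral_shell_enorm_inv_homNorm_rpow_le n
  refine ⟨J, hJ, fun R hR hlog u hu => ?_⟩
  have : 0 < Real.log R := by linarith
  set μ := volume.restrict (shell n 1 (R ^ 3))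
  have hsq_rpow (x : ℝ≥0∞) (r : ℝ) : (x ^ 2) ^ (r / 2) = x ^ r := by
    rw [← ENNReal.rpow_natCast_mul]
    congr 1
    push_cast
    ring
  have hJlog : ENNReal.ofReal (J * Real.log R) ^ (2 / (homDim n : ℝ)) ≤
      ENNReal.ofReal (J * Real.log R) := by
    have hQ := four_le_homDim hn
    have hexp : 2 / (homDim n : ℝ) ≤ 1 := (div_le_one (by linarith)).2 (by linarith)
    exact ennreal_rpow_le_self_of_one_le
      (ENNReal.one_le_ofReal.2 (one_le_mul_of_one_le_of_one_le hJ hlog)) hexp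
  have hholder := ENNReal.lintegral_mul_le_Lp_mul_Lq μ (holderConjugate_sobExp_div_two hn)
    (hu.enorm.pow_const 2)
    (continuous_homNorm.measurable.inv.enorm.pow_const 2).aemeasurable
  simp only [Pi.mul_apply, hsq_rpow, one_div_div] at hholder
  calc ∫⁻ p, ‖u p / (Real.log R * homNorm p)‖ₑ ^ 2 ∂μ
      = ENNReal.ofReal ((Real.log R)⁻¹ ^ 2) * ∫⁻ p, ‖u p‖ₑ ^ 2 * ‖(homNorm p)⁻¹‖ₑ ^ 2 ∂μ := by
        rw [← lintegral_const_mul' _ _ ENNReal.ofReal_ne_top]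
        refine lintegral_congr fun p => ?_
        rw [ENNReal.ofReal_pow (by positivity), ← Real.enorm_of_nonneg (by positivity), ← mul_pow,
          ← mul_pow, ← enorm_mul, ← enorm_mul]
        congr 2
        ring
    _ ≤ ENNReal.ofReal ((Real.log R)⁻¹ ^ 2) * ((∫⁻ p, ‖u p‖ₑ ^ sobExp n ∂μ) ^ (2 / sobExp n) *
          ENNReal.ofReal (J * Real.log R)) := by
        gcongr
        refine hholder.trans ?_
        gcongr
        exact (ENNReal.rpow_le_rpow (hweight R hR hlog) (by positivity)).trans hJlog
    _ = _ := by
        rw [mul_left_comm, ← ENNReal.ofReal_mul (by positivity), mul_comm]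
        congr 2
        field_simp

/-! ### The inequality over one period -/

theorem ne_zero_of_mem_shell_one {T : ℝ} {p : Heis n} (hp : p ∈ shell n 1 T) : p ≠ 0 :=
  annulus_subset_compl_zero T (shell_one_subset_annulus T hp)

theorem exists_enorm_logCutoff_mul_add_sq_le (n : ℕ) :
    ∃ D : ℝ, 0 < D ∧ ∀ R : ℝ, 1 < R → ∀ (j : Fin n ⊕ Fin n) (p : Heis n), p ≠ 0 → ∀ a b : ℝ,
      ‖logCutoff R p * a + frameDeriv j (logCutoff R) p * b‖ₑ ^ 2 ≤
        ENNReal.ofReal D * (‖a‖ₑ ^ 2 + ‖b / (Real.log R * homNorm p)‖ₑ ^ 2) := by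
  obtain ⟨B, hB, hderiv⟩ := exists_abs_frameDeriv_logCutoff_le n
  have henorm_sq (x : ℝ) : ‖x‖ₑ ^ 2 = ENNReal.ofReal (x ^ 2) := by
    rw [← enorm_pow, Real.enorm_of_nonneg (sq_nonneg x)]
  refine ⟨2 + 2 * B ^ 2, by positivity, fun R hR j p hp a b => ?_⟩
  rw [henorm_sq, henorm_sq, henorm_sq, ← ENNReal.ofReal_add (sq_nonneg _) (sq_nonneg _),
    ← ENNReal.ofReal_mul (by positivity)]
  refine ENNReal.ofReal_le_ofReal ?_
  have hfst : (logCutoff R p * a) ^ 2 ≤ a ^ 2 := by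
    rw [mul_pow]
    exact mul_le_of_le_one_left (sq_nonneg a)
      (pow_le_one₀ (logCutoff_nonneg R p) (logCutoff_le_one R p))
  have hsnd : (frameDeriv j (logCutoff R) p * b) ^ 2 ≤
      B ^ 2 * (b / (Real.log R * homNorm p)) ^ 2 := by
    calc (frameDeriv j (logCutoff R) p * b) ^ 2
        = |frameDeriv j (logCutoff R) p| ^ 2 * b ^ 2 := by rw [mul_pow, sq_abs]
      _ ≤ (B / (Real.log R * homNorm p)) ^ 2 * b ^ 2 := by
          gcongr
          exact hderiv R hR j p hp
      _ = B ^ 2 * (b / (Real.log R * homNorm p)) ^ 2 := by ring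
  have hsplit := add_sq_le (a := logCutoff R p * a) (b := frameDeriv j (logCutoff R) p * b)
  nlinarith [mul_nonneg (sq_nonneg B) (sq_nonneg a),
    sq_nonneg (b / (Real.log R * homNorm p))]

theorem sobolev_logCutoff (hn : 1 ≤ n) :
    ∃ C : ℝ, 0 < C ∧ ∀ R : ℝ, 1 < R → ∀ (u : Heis n → ℝ) (g : Fin n ⊕ Fin n → Heis n → ℝ),
      MemL2loc {0}ᶜ u → (∀ j, IsWeakFrameDeriv {0}ᶜ j u (g j)) →
      (∫⁻ p in shell n R (R ^ 2), ‖u p‖ₑ ^ sobExp n) ^ (2 / sobExp n) ≤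
        ENNReal.ofReal C * ∫⁻ p in shell n 1 (R ^ 3),
          (∑ j, ‖g j p‖ₑ ^ 2 + ‖u p / (Real.log R * homNorm p)‖ₑ ^ 2) := by
  obtain ⟨C, hC, hsobolev⟩ := sobolev_weak hn
  obtain ⟨D, hD, hpointwise⟩ := exists_enorm_logCutoff_mul_add_sq_le n
  refine ⟨C * ((2 * n : ℕ) * D), by positivity, fun R hR u g hu hg => ?_⟩
  have hη := contDiff_logCutoff (n := n) hR
  have hηU := (tsupport_logCutoff_subset (n := n) hR).trans (annulus_subset_compl_zero _)
  have hcutoff := hsobolev _ _ (hasCompactSupport_logCutoff hR).mul_right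
    (hu.memLp_mul hη.continuous (hasCompactSupport_logCutoff hR) hηU) fun j =>
      (hg j).cutoff_mul isOpen_compl_singleton hu hη (hasCompactSupport_logCutoff hR) hηU
  have hsupport (j : Fin n ⊕ Fin n) :
      (fun p => ‖logCutoff R p * g j p + frameDeriv j (logCutoff R) p * u p‖ₑ ^ 2).support ⊆
        shell n 1 (R ^ 3) := by
    refine Function.support_subset_iff'.2 fun p hp => ?_
    have hout : homNorm p ≤ 1 ∨ R ^ 3 ≤ homNorm p := by
      by_contra! h
      exact hp ⟨h.1.le, h.2⟩
    simp [logCutoff_eq_zero hR hout, frameDeriv_logCutoff_eq_zero hR j hout]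
  have hterm (j : Fin n ⊕ Fin n) :
      ∫⁻ p, ‖logCutoff R p * g j p + frameDeriv j (logCutoff R) p * u p‖ₑ ^ 2 ≤
        ENNReal.ofReal D * ∫⁻ p in shell n 1 (R ^ 3),
          (∑ i, ‖g i p‖ₑ ^ 2 + ‖u p / (Real.log R * homNorm p)‖ₑ ^ 2) := by
    rw [← setLIntegral_eq_of_support_subset (hsupport j),
      ← lintegral_const_mul' _ _ ENNReal.ofReal_ne_top]
    refine setLIntegral_mono' (measurableSet_shell _ _) fun p hp => ?_
    refine (hpointwise R hR j p (ne_zero_of_mem_shell_one hp) _ _).trans ?_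
    gcongr
    exact Finset.single_le_sum (f := fun i => ‖g i p‖ₑ ^ 2) (fun _ _ => zero_le)
      (Finset.mem_univ j)
  calc (∫⁻ p in shell n R (R ^ 2), ‖u p‖ₑ ^ sobExp n) ^ (2 / sobExp n)
      ≤ (∫⁻ p, ‖logCutoff R p * u p‖ₑ ^ sobExp n) ^ (2 / sobExp n) := by
        refine ENNReal.rpow_le_rpow ?_ (by have := sobExp_pos hn; positivity)
        refine (setLIntegral_congr_fun (measurableSet_shell _ _) fun p hp => ?_).trans_le
          (setLIntegral_le_lintegral (shell n R (R ^ 2)) _)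
        rw [logCutoff_eq_one hR hp.1 hp.2.le, one_mul]
    _ ≤ _ := hcutoff.trans (mul_le_mul_right (Finset.sum_le_sum fun j _ => hterm j) _)
    _ = _ := by
        rw [Finset.sum_const, Finset.card_univ, Fintype.card_sum, Fintype.card_fin, ← two_mul,
          nsmul_eq_mul, ENNReal.ofReal_mul hC.le, ENNReal.ofReal_mul (Nat.cast_nonneg _),
          ENNReal.ofReal_natCast, mul_assoc, mul_assoc]

theorem exists_sobolev_shell_le_add (hn : 1 ≤ n) :
    ∃ C : ℝ, 0 < C ∧ ∀ R : ℝ, 0 < R → 1 ≤ Real.log R →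
      ∀ (u : Heis n → ℝ) (g : Fin n ⊕ Fin n → Heis n → ℝ),
        MemL2loc {0}ᶜ u → (∀ j, IsWeakFrameDeriv {0}ᶜ j u (g j)) →
        (∫⁻ p in shell n R (R ^ 2), ‖u p‖ₑ ^ sobExp n) ^ (2 / sobExp n) ≤
          ENNReal.ofReal C * (∫⁻ p in shell n 1 (R ^ 3), ∑ j, ‖g j p‖ₑ ^ 2) +
            ENNReal.ofReal (C / Real.log R) *
              (∫⁻ p in shell n 1 (R ^ 3), ‖u p‖ₑ ^ sobExp n) ^ (2 / sobExp n) := by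
  obtain ⟨C, hC, hcutoff⟩ := sobolev_logCutoff hn
  obtain ⟨J, hJ, hhardy⟩ := exists_lintegral_shell_hardy_le hn
  refine ⟨C * J, by positivity, fun R hR hlog u g hu hg => ?_⟩
  have hR1 : 1 < R := (Real.log_pos_iff hR.le).1 (by linarith)
  have hgrad : AEMeasurable (fun p => ∑ j, ‖g j p‖ₑ ^ 2)
      (volume.restrict (shell n 1 (R ^ 3))) :=
    Finset.aemeasurable_fun_sum _ fun j _ =>
      ((hg j).1.memLp_shell (R ^ 3)).aestronglyMeasurable.enorm.pow_const 2
  refine (hcutoff R hR1 u g hu hg).trans ?_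
  rw [lintegral_add_left' hgrad, mul_add]
  refine add_le_add (mul_le_mul_left (ENNReal.ofReal_le_ofReal ?_) _) ?_
  · exact le_mul_of_one_le_right hC.le hJ
  · refine (mul_le_mul_right
      (hhardy R hR hlog u (hu.memLp_shell (R ^ 3)).aestronglyMeasurable) _).trans_eq ?_
    rw [← mul_assoc, ← ENNReal.ofReal_mul hC.le, mul_div_assoc]

theorem lintegral_shell_enorm_sobExp_ne_top (hn : 1 ≤ n) {R : ℝ} (hR : 0 < R)
    (hlog : 1 ≤ Real.log R) {u : Heis n → ℝ} (hu : MemS1loc {0}ᶜ u) :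
    ∫⁻ p in shell n R (R ^ 2), ‖u p‖ₑ ^ sobExp n ≠ ⊤ := by
  obtain ⟨C, -, hcutoff⟩ := sobolev_logCutoff hn
  choose g hg using hu.2
  have hR1 : 1 < R := (Real.log_pos_iff hR.le).1 (by linarith)
  have hsq_ne_top {f : Heis n → ℝ} (hf : MemL2loc {0}ᶜ f) :
      ∫⁻ p in shell n 1 (R ^ 3), ‖f p‖ₑ ^ 2 ≠ ⊤ := by
    rw [← eLpNorm_two_sq]
    exact ENNReal.pow_ne_top (hf.memLp_shell _).eLpNorm_ne_top
  have hsum_ne_top : ∫⁻ p in shell n 1 (R ^ 3), ∑ j, ‖g j p‖ₑ ^ 2 ≠ ⊤ := by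
    rw [lintegral_finsetSum' _ fun j _ =>
      ((hg j).1.memLp_shell (R ^ 3)).aestronglyMeasurable.enorm.pow_const 2]
    exact ENNReal.sum_ne_top.2 fun j _ => hsq_ne_top (hg j).1
  have hbound : (∫⁻ p in shell n R (R ^ 2), ‖u p‖ₑ ^ sobExp n) ^ (2 / sobExp n) ≤
      ENNReal.ofReal C * ((∫⁻ p in shell n 1 (R ^ 3), ∑ j, ‖g j p‖ₑ ^ 2) +
        ∫⁻ p in shell n 1 (R ^ 3), ‖u p‖ₑ ^ 2) := by
    refine (hcutoff R hR1 u g hu.1 hg).trans (mul_le_mul_right ?_ _)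
    rw [← lintegral_add_right' _
      ((hu.1.memLp_shell (R ^ 3)).aestronglyMeasurable.enorm.pow_const 2)]
    refine setLIntegral_mono' (measurableSet_shell _ _) fun p hp => ?_
    gcongr
    rw [enorm_le_iff_norm_le, norm_div]
    refine div_le_self (norm_nonneg _) (le_trans ?_ (le_abs_self _))
    exact one_le_mul_of_one_le_of_one_le hlog hp.1
  intro htop
  rw [htop, ENNReal.top_rpow_of_pos (by have := sobExp_pos hn; positivity), top_le_iff] at hbound
  exact ENNReal.mul_ne_top ENNReal.ofReal_ne_top (ENNReal.add_ne_top.2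
    ⟨hsum_ne_top, hsq_ne_top hu.1⟩) hbound

theorem isWeakFrameDeriv_weakGrad {U : Set (Heis n)} {u : Heis n → ℝ} (hu : MemS1loc U u)
    (j : Fin n ⊕ Fin n) : IsWeakFrameDeriv U j u (weakGrad U u j) := by
  rw [weakGrad, dif_pos (hu.2 j)]
  exact (hu.2 j).choose_spec

theorem isDilationInvariant_enorm_sobExp (hn : 1 ≤ n) {T : ℝ} (hT : 0 < T) {u : Heis n → ℝ}
    (hu : u ∈ XSpace n T) : IsDilationInvariant T fun p => ‖u p‖ₑ ^ sobExp n := by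
  have hQ := four_le_homDim hn
  refine isDilationInvariant_enorm_rpow hT (sobExp_pos hn).le ?_ hu.2
  have hQ2 : (homDim n : ℝ) - 2 ≠ 0 := by linarith
  rw [sobExp]
  field_simp

theorem isDilationInvariant_sum_enorm_weakGrad_sq {T : ℝ} (hT : 0 < T) {u : Heis n → ℝ}
    (hu : u ∈ XSpace n T) :
    IsDilationInvariant T fun p => ∑ j, ‖weakGrad {0}ᶜ u j p‖ₑ ^ 2 := by
  refine IsDilationInvariant.sum fun j => ?_
  simp only [← ENNReal.rpow_two]
  refine isDilationInvariant_enorm_rpow (s := homDim n / 2) hT two_pos.le (by ring) ?_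
  filter_upwards [(isWeakFrameDeriv_weakGrad hu.1 j).ae_comp_dilation_eq hT hu.2] with p hp
  rw [hp, ← Real.rpow_neg_one T, ← Real.rpow_add hT]
  congr 2
  ring

theorem ennreal_le_two_mul_of_le_add_half {x a : ℝ≥0∞} (hx : x ≠ ⊤) (h : x ≤ a + x / 2) :
    x ≤ 2 * a := by
  have hhalf : x / 2 ≤ a := by
    refine (ENNReal.add_le_add_iff_right (ENNReal.div_ne_top hx two_ne_zero)).1 ?_
    rwa [ENNReal.add_halves]
  rw [← ENNReal.add_halves x, two_mul]
  exact add_le_add hhalf hhalf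

theorem sobolev_periods_le_add (hn : 1 ≤ n) :
    ∃ C : ℝ, 0 < C ∧ ∀ T : ℝ, 1 < T → ∀ u ∈ XSpace n T, ∀ k : ℕ, 1 ≤ k * Real.log T →
      (k * ∫⁻ p in shell n 1 T, ‖u p‖ₑ ^ sobExp n) ^ (2 / sobExp n) ≤
        ENNReal.ofReal C * (k * ∫⁻ p in shell n 1 T, ∑ j, ‖weakGrad {0}ᶜ u j p‖ₑ ^ 2) +
          ENNReal.ofReal (C / (k * Real.log T)) *
            (k * ∫⁻ p in shell n 1 T, ‖u p‖ₑ ^ sobExp n) ^ (2 / sobExp n) := by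
  obtain ⟨C, hC, hshell⟩ := exists_sobolev_shell_le_add hn
  refine ⟨C * 3, by positivity, fun T hT u hu k hk => ?_⟩
  have hT0 : 0 < T := by linarith
  have hlog : Real.log (T ^ k) = k * Real.log T := Real.log_pow T k
  have hinner {W : Heis n → ℝ≥0∞} (hW : IsDilationInvariant T W) :
      ∫⁻ p in shell n (T ^ k) ((T ^ k) ^ 2), W p = k * ∫⁻ p in shell n 1 T, W p := by
    rw [← pow_mul, mul_two, hW.lintegral_shell_pow hT.le]
  have houter {W : Heis n → ℝ≥0∞} (hW : IsDilationInvariant T W) :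
      ∫⁻ p in shell n 1 ((T ^ k) ^ 3), W p = 3 * (k * ∫⁻ p in shell n 1 T, W p) := by
    have h := hW.lintegral_shell_pow hT.le 0 (k * 3)
    rw [pow_zero, zero_add, pow_mul] at h
    rw [h]
    push_cast
    ring
  have hu_inv := isDilationInvariant_enorm_sobExp hn hT0 hu
  have hbound := hshell (T ^ k) (pow_pos hT0 k) (hlog ▸ hk) u (weakGrad {0}ᶜ u) hu.1.1
    (isWeakFrameDeriv_weakGrad hu.1)
  rw [hinner hu_inv, houter hu_inv, hlog,
    houter (isDilationInvariant_sum_enorm_weakGrad_sq hT0 hu),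
    ENNReal.mul_rpow_of_nonneg 3 _ (by have := sobExp_pos hn; positivity)] at hbound
  refine hbound.trans ?_
  rw [mul_div_right_comm, ENNReal.ofReal_mul hC.le, ENNReal.ofReal_mul (by positivity),
    ENNReal.ofReal_ofNat, mul_assoc, mul_assoc]
  gcongr
  exact ennreal_rpow_le_self_of_one_le (by norm_num) (two_div_sobExp_lt_one hn).le

theorem lintegral_shell_one_enorm_sobExp_ne_top (hn : 1 ≤ n) {T : ℝ} (hT : 1 < T)
    {u : Heis n → ℝ} (hu : u ∈ XSpace n T) : ∫⁻ p in shell n 1 T, ‖u p‖ₑ ^ sobExp n ≠ ⊤ := by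
  have hT0 : 0 < T := by linarith
  set k := ⌈1 / Real.log T⌉₊
  have hk : 1 ≤ k * Real.log T := (div_le_iff₀ (Real.log_pos hT)).1 (Nat.le_ceil _)
  have hk0 : k ≠ 0 := by
    rintro h
    norm_num [h] at hk
  have hfinite := lintegral_shell_enorm_sobExp_ne_top hn (pow_pos hT0 k)
    (by rwa [Real.log_pow]) hu.1
  rw [← pow_mul, mul_two,
    (isDilationInvariant_enorm_sobExp hn hT0 hu).lintegral_shell_pow hT.le] at hfinite
  exact fun h => hfinite (by rw [h, ENNReal.mul_top (Nat.cast_ne_zero.2 hk0)])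

theorem sobolev_periods (hn : 1 ≤ n) :
    ∃ A C : ℝ, 1 ≤ A ∧ 0 < C ∧ ∀ T : ℝ, 1 < T → ∀ u ∈ XSpace n T, ∀ k : ℕ, A ≤ k * Real.log T →
      (k * ∫⁻ p in shell n 1 T, ‖u p‖ₑ ^ sobExp n) ^ (2 / sobExp n) ≤
        ENNReal.ofReal C * (k * ∫⁻ p in shell n 1 T, ∑ j, ‖weakGrad {0}ᶜ u j p‖ₑ ^ 2) := by
  obtain ⟨C, hC, hperiods⟩ := sobolev_periods_le_add hn
  refine ⟨1 + 2 * C, 2 * C, by linarith, by positivity, fun T hT u hu k hk => ?_⟩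
  have hbound := hperiods T hT u hu k (by linarith)
  have hhalf : ENNReal.ofReal (C / (k * Real.log T)) ≤ 2⁻¹ := by
    rw [← ENNReal.ofReal_ofNat, ← ENNReal.ofReal_inv_of_pos two_pos]
    refine ENNReal.ofReal_le_ofReal ?_
    rw [inv_eq_one_div, div_le_div_iff₀ (by linarith) two_pos]
    linarith
  set X := (k * ∫⁻ p in shell n 1 T, ‖u p‖ₑ ^ sobExp n) ^ (2 / sobExp n)
  have hX : X ≠ ⊤ := ENNReal.rpow_ne_top_of_nonneg (by have := sobExp_pos hn; positivity)
    (ENNReal.mul_ne_top (ENNReal.natCast_ne_top k)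
      (lintegral_shell_one_enorm_sobExp_ne_top hn hT hu))
  rw [ENNReal.ofReal_mul two_pos.le, ENNReal.ofReal_ofNat, mul_assoc]
  refine ennreal_le_two_mul_of_le_add_half hX (hbound.trans ?_)
  rw [ENNReal.div_eq_inv_mul]
  gcongr

theorem sobolev_shell (hn : 1 ≤ n) :
    ∃ A C : ℝ, 1 ≤ A ∧ 0 < C ∧ ∀ T : ℝ, 1 < T → ∀ u ∈ XSpace n T, ∀ k : ℕ, A ≤ k * Real.log T →
      (∫⁻ p in shell n 1 T, ‖u p‖ₑ ^ sobExp n) ^ (2 / sobExp n) ≤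
        ENNReal.ofReal (C * (k : ℝ) ^ (2 / (homDim n : ℝ))) *
          ∫⁻ p in shell n 1 T, ∑ j, ‖weakGrad {0}ᶜ u j p‖ₑ ^ 2 := by
  obtain ⟨A, C, hA, hC, hperiods⟩ := sobolev_periods hn
  refine ⟨A, C, hA, hC, fun T hT u hu k hk => ?_⟩
  have hk0 : 0 < (k : ℝ) := by
    by_contra! h
    nlinarith [Real.log_pos hT]
  have hsplit : (k : ℝ) = (k : ℝ) ^ (2 / sobExp n) * (k : ℝ) ^ (2 / (homDim n : ℝ)) := by
    rw [← Real.rpow_add hk0, two_div_sobExp hn, sub_add_cancel, Real.rpow_one]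
  have hscaled := hperiods T hT u hu k hk
  rw [← ENNReal.ofReal_natCast, ENNReal.mul_rpow_of_nonneg _ _
    (by have := sobExp_pos hn; positivity), ENNReal.ofReal_rpow_of_pos hk0] at hscaled
  refine (ENNReal.mul_le_mul_iff_right (a := ENNReal.ofReal ((k : ℝ) ^ (2 / sobExp n)))
    (by simpa using by positivity) ENNReal.ofReal_ne_top).1 (hscaled.trans_eq ?_)
  rw [← mul_assoc, ← mul_assoc, ← ENNReal.ofReal_mul hC.le, ← ENNReal.ofReal_mul (by positivity),
    mul_left_comm, ← hsplit]

theorem lintegral_shell_weakGrad_sq_le {T : ℝ} {u : Heis n → ℝ} (hu : MemS1loc {0}ᶜ u) :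
    ∫⁻ p in shell n 1 T, ∑ j, ‖weakGrad {0}ᶜ u j p‖ₑ ^ 2 ≤ ENNReal.ofReal (XInner T u u) := by
  have hmem (j : Fin n ⊕ Fin n) :
      MemLp (weakGrad {0}ᶜ u j) 2 (volume.restrict (annulus n T)) :=
    (isWeakFrameDeriv_weakGrad hu j).1 _ (isCompact_annulus T) (annulus_subset_compl_zero T)
  have hintegrable : Integrable (fun p => ∑ j, weakGrad {0}ᶜ u j p * weakGrad {0}ᶜ u j p)
      (volume.restrict (annulus n T)) :=
    integrable_finsetSum _ fun j _ => (hmem j).integrable_mul (hmem j)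
  rw [XInner, ofReal_integral_eq_lintegral_ofReal hintegrable
    (Eventually.of_forall fun p => Finset.sum_nonneg fun j _ => mul_self_nonneg _)]
  refine (lintegral_mono_set (shell_one_subset_annulus T)).trans_eq (lintegral_congr fun p => ?_)
  rw [ENNReal.ofReal_sum_of_nonneg fun j _ => mul_self_nonneg _]
  refine Finset.sum_congr rfl fun j _ => ?_
  rw [← enorm_pow, Real.enorm_of_nonneg (sq_nonneg _), sq]

theorem sobolev_annulus (hn : 1 ≤ n) :
    ∃ A C : ℝ, 1 ≤ A ∧ 0 < C ∧ ∀ T : ℝ, 1 < T → ∀ u ∈ XSpace n T, ∀ k : ℕ, A ≤ k * Real.log T →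
      eLpNorm u (ENNReal.ofReal (sobExp n)) (volume.restrict (annulus n T)) ≤
        ENNReal.ofReal (C * (k : ℝ) ^ (1 / (homDim n : ℝ)) * XNorm T u) := by
  obtain ⟨A, C, hA, hC, hshell⟩ := sobolev_shell hn
  refine ⟨A, √(2 * C), hA, by positivity, fun T hT u hu k hk => ?_⟩
  have hq := sobExp_pos hn
  have hpos : 0 ≤ 2 / sobExp n := by positivity
  set I := ∫⁻ p in shell n 1 T, ‖u p‖ₑ ^ sobExp n
  have hannulus := (isDilationInvariant_enorm_sobExp hn (by linarith) hu).lintegral_annulus_le hT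
  rw [eLpNorm_eq_lintegral_rpow_enorm_toReal (by simpa using hq) ENNReal.ofReal_ne_top,
    ENNReal.toReal_ofReal hq.le]
  calc (∫⁻ p in annulus n T, ‖u p‖ₑ ^ sobExp n) ^ (1 / sobExp n)
      ≤ (2 * I) ^ (1 / sobExp n) := by gcongr
    _ = (2 ^ (2 / sobExp n) * I ^ (2 / sobExp n)) ^ (1 / 2 : ℝ) := by
        rw [← ENNReal.mul_rpow_of_nonneg _ _ hpos, ← ENNReal.rpow_mul]
        congr 1
        ring
    _ ≤ (2 * (ENNReal.ofReal (C * (k : ℝ) ^ (2 / (homDim n : ℝ))) *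
          ENNReal.ofReal (XInner T u u))) ^ (1 / 2 : ℝ) := by
        gcongr
        · exact ennreal_rpow_le_self_of_one_le one_le_two (two_div_sobExp_lt_one hn).le
        · exact (hshell T hT u hu k hk).trans
            (mul_le_mul_right (lintegral_shell_weakGrad_sq_le hu.1) _)
    _ = ENNReal.ofReal (√(2 * C) * (k : ℝ) ^ (1 / (homDim n : ℝ)) * XNorm T u) := by
        have hinner : 0 ≤ XInner T u u :=
          integral_nonneg fun p => Finset.sum_nonneg fun j _ => mul_self_nonneg _
        have hsqrt : √((k : ℝ) ^ (2 / (homDim n : ℝ))) = (k : ℝ) ^ (1 / (homDim n : ℝ)) := by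
          rw [Real.sqrt_eq_rpow, ← Real.rpow_mul (Nat.cast_nonneg k)]
          congr 1
          ring
        rw [← ENNReal.ofReal_mul (by positivity), ← ENNReal.ofReal_ofNat 2,
          ← ENNReal.ofReal_mul two_pos.le, ENNReal.ofReal_rpow_of_nonneg (by positivity)
          (by norm_num), ← Real.sqrt_eq_rpow, XNorm, ← hsqrt, ← Real.sqrt_mul (by positivity),
          ← Real.sqrt_mul (by positivity), mul_assoc, mul_assoc, mul_assoc]

/-! ### The dependence on the period -/

theorem inv_log_le_div_sub_one {x : ℝ} (hx : 1 < x) : (Real.log x)⁻¹ ≤ x / (x - 1) := by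
  rw [inv_le_comm₀ (Real.log_pos hx) (div_pos (by linarith) (by linarith)), inv_div, sub_div,
    div_self (by linarith), one_div]
  exact Real.one_sub_inv_le_log_of_pos (one_pos.trans hx)

theorem natCeil_div_le {A L : ℝ} (hA : 1 ≤ A) (hL : 0 < L) :
    (⌈A / L⌉₊ : ℝ) ≤ 2 * A * max 1 L⁻¹ := by
  rcases le_total L A with hLA | hLA
  · have hone : 1 ≤ A / L := (one_le_div hL).2 hLA
    calc (⌈A / L⌉₊ : ℝ) ≤ A / L + 1 := (Nat.ceil_lt_add_one (by positivity)).le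
      _ ≤ 2 * A * L⁻¹ := by linarith [show 2 * A * L⁻¹ = A / L + A / L by ring]
      _ ≤ 2 * A * max 1 L⁻¹ := by gcongr; exact le_max_right _ _
  · calc (⌈A / L⌉₊ : ℝ) ≤ 1 := by
          exact_mod_cast Nat.ceil_le.2 (by simpa using (div_le_one hL).2 hLA)
      _ ≤ 2 * A * max 1 L⁻¹ := by nlinarith [le_max_left 1 L⁻¹]

theorem max_one_inv_log_rpow_le {T Q : ℝ} (hT : 1 < T) (hQ : 2 ≤ Q) :
    max 1 (Real.log T)⁻¹ ^ (1 / Q) ≤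
      √Q * Real.log T ^ ((Q - 2) / (2 * Q)) * (T ^ Q / (T ^ Q - 1)) ^ (1 / 2 : ℝ) := by
  set L := Real.log T
  set F := T ^ Q / (T ^ Q - 1)
  have hL : 0 < L := Real.log_pos hT
  have hTQ : 1 < T ^ Q := Real.one_lt_rpow hT (by linarith)
  have hFone : 1 ≤ F := (one_le_div (by linarith)).2 (by linarith)
  have hexp : (Q - 2) / (2 * Q) = 1 / 2 - 1 / Q := by field_simp
  rcases le_total 1 L with hL1 | hL1
  · rw [max_eq_left (inv_le_one_of_one_le₀ hL1), Real.one_rpow]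
    have hLpow : 1 ≤ L ^ ((Q - 2) / (2 * Q)) :=
      Real.one_le_rpow hL1 (div_nonneg (by linarith) (by linarith))
    exact one_le_mul_of_one_le_of_one_le (one_le_mul_of_one_le_of_one_le
      (Real.one_le_sqrt.2 (by linarith)) hLpow) (Real.one_le_rpow hFone (by norm_num))
  · have hinv : L⁻¹ ≤ Q * F := by
      have h := inv_log_le_div_sub_one hTQ
      rw [Real.log_rpow (by linarith), mul_inv, inv_mul_le_iff₀ (by linarith)] at h
      exact h
    rw [max_eq_right ((one_le_inv₀ hL).2 hL1)]
    calc L⁻¹ ^ (1 / Q) = L ^ ((Q - 2) / (2 * Q)) * L⁻¹ ^ (1 / 2 : ℝ) := by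
          rw [Real.inv_rpow hL.le, Real.inv_rpow hL.le, hexp, ← Real.rpow_neg hL.le,
            ← Real.rpow_neg hL.le, ← Real.rpow_add hL]
          congr 1
          ring
      _ ≤ L ^ ((Q - 2) / (2 * Q)) * (Q * F) ^ (1 / 2 : ℝ) := by gcongr
      _ = √Q * L ^ ((Q - 2) / (2 * Q)) * F ^ (1 / 2 : ℝ) := by
          rw [Real.mul_rpow (by linarith) (by linarith), Real.sqrt_eq_rpow]
          ring

theorem natCeil_div_log_rpow_le (hn : 1 ≤ n) {A T : ℝ} (hA : 1 ≤ A) (hT : 1 < T) :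
    (⌈A / Real.log T⌉₊ : ℝ) ^ (1 / (homDim n : ℝ)) ≤
      (2 * A) ^ (1 / (homDim n : ℝ)) * √(homDim n) *
        (Real.log T ^ (((homDim n : ℝ) - 2) / (2 * homDim n)) *
          (T ^ homDim n / (T ^ homDim n - 1)) ^ (1 / 2 : ℝ)) := by
  have hperiod := max_one_inv_log_rpow_le hT (by linarith [four_le_homDim hn] : 2 ≤ (homDim n : ℝ))
  rw [Real.rpow_natCast] at hperiod
  calc (⌈A / Real.log T⌉₊ : ℝ) ^ (1 / (homDim n : ℝ))
      ≤ (2 * A * max 1 (Real.log T)⁻¹) ^ (1 / (homDim n : ℝ)) := by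
        gcongr
        exact natCeil_div_le hA (Real.log_pos hT)
    _ = (2 * A) ^ (1 / (homDim n : ℝ)) * max 1 (Real.log T)⁻¹ ^ (1 / (homDim n : ℝ)) :=
        Real.mul_rpow (by positivity) (by positivity)
    _ ≤ _ := by
        rw [mul_assoc, ← mul_assoc (√_)]
        gcongr

end Heisenberg

theorem mainTheorem4 (n : ℕ) (hn : 1 ≤ n) :
    ∃ C : ℝ, 0 < C ∧ ∀ T : ℝ, 1 < T → ∀ u ∈ Heisenberg.XSpace n T,
      eLpNorm u
          (ENNReal.ofReal
            (2 * (Heisenberg.homDim n : ℝ) / ((Heisenberg.homDim n : ℝ) - 2)))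
          (volume.restrict (Heisenberg.annulus n T)) ≤
        ENNReal.ofReal
          (C * Real.log T ^
              (((Heisenberg.homDim n : ℝ) - 2) / (2 * (Heisenberg.homDim n : ℝ))) *
            (T ^ Heisenberg.homDim n / (T ^ Heisenberg.homDim n - 1)) ^ (1 / 2 : ℝ) *
            Heisenberg.XNorm T u) := by
  open Heisenberg in
  obtain ⟨A, C, hA, hC, hsobolev⟩ := sobolev_annulus hn
  have hQ := four_le_homDim hn
  set D := (2 * A) ^ (1 / (homDim n : ℝ)) * √(homDim n) with hD
  refine ⟨C * D, by positivity, fun T hT u hu => ?_⟩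
  set k := ⌈A / Real.log T⌉₊ with hk
  have hcover : A ≤ k * Real.log T := (div_le_iff₀ (Real.log_pos hT)).1 (Nat.le_ceil _)
  have hperiods := natCeil_div_log_rpow_le hn hA hT
  rw [← hk, ← hD] at hperiods
  refine (hsobolev T hT u hu k hcover).trans (ENNReal.ofReal_le_ofReal ?_)
  refine mul_le_mul_of_nonneg_right ?_ (Real.sqrt_nonneg _)
  rw [mul_assoc, mul_assoc]
  gcongr
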